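/- **Setting.** Let $\Omega\subset\mathbb R^n$ be open and bounded, $0<\beta<1$, $m\in\mathbb R$. A topology is $\chi:\Omega\to\{\beta,1\}$ (value $1$ on the hard phase, $\beta$ on the soft phase); $\Delta\chi(x)=-(1-\beta)$ where $\chi(x)=1$ and $\Delta\chi(x)=1-\beta$ where $\chi(x)=\beta$. Let $B$ be a bounded measurable strain-matrix field on $\Omega$ with values in $\mathbb R^{p\times N}$ such that $B(x)d=0$ for a.e. $x\in\Omega$ only for $d=0$ (no rigid motions), let $\mathbb D\in\mathbb R^{p\times p}$ be symmetric positive definite and $f\in\mathbb R^N$. The discretized relaxed elastic state $d_\chi\in\mathbb R^N$ is the solution of $$K_\chi d_\chi=f,\qquad K_\chi=\int_\Omega \chi^m\,B^T\mathbb D B\,dx .$$ Let $$J(\chi)=\int_\Omega G(\chi(x),d_\chi,x)\,dx,\qquad C(\chi)=|\{x\in\Omega:\chi(x)=1\}|-\bar V,\qquad L(\chi,\lambda)=J(\chi)+\lambda C(\chi),$$ where, for $c\in\{\beta,1\}$, $G(c,d,x)$ is measurable in $x$, differentiable in $d$, and for every $R$ both $|G(c,d,x)|$ and $\|\partial_dG(c,d,x)\|$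 are bounded, for $\|d\|\le R$, by a function in $L^1(\Omega)$. The relaxed topological derivative of $L$ at $y\in\Omega$ is $$\frac{\delta L(\chi,\lambda)}{\delta\chi}(y)=\lim_{\varepsilon\to0^+}\frac{L(\chi+\mathbf 1_{B_\varepsilon(y)}\Delta\chi,\lambda)-L(\chi,\lambda)}{|B_\varepsilon(y)|}.$$ For $\phi:\Omega\to\mathbb R$ put $H_\beta(\phi)=1$ where $\phi>0$ and $H_\beta(\phi)=\beta$ elsewhere. **Theorem.** Let $k>0$, $\lambda\in\mathbb R$, $T>0$, and let $\phi_t(x)$ be of class $C^1$ in $(t,x)$ on a neighbourhood of $[0,T]\times\overline\Omega$. Put $\chi_t=H_\beta(\phi_t)$, $\Gamma_t=\{x\in\Omega:\phi_t(x)=0\}$, and suppose that for all $t\in[0,T]$ and $x\in\Omega\setminus\Gamma_t$ the relaxed topological derivative exists and $$\dot\phi_t(x)=-k\,\frac1{\Delta\chi_t(x)}\,\frac{\delta L(\chi_t,\lambda)}{\delta\chi}(x).$$ Let $t\in[0,T]$ be such that $\nabla\phi_t\ne0$ on $\{x\in\overline\Omega:\phi_t(x)=0\}$, the set $\{x\in\partial\Omega:\phi_t(x)=0\}$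 has zero $(n-1)$-dimensional Hausdorff measure, and the interface is not stationary, i.e. $\dot\phi_t(x)\neq0$ for some $x\in\Gamma_t$. Then $s\mapsto L(\chi_s,\lambda)$ is differentiable at $t$ (as a function on $[0,T]$) and $$\dot L(\chi_t,\lambda)<0 .$$ If this condition holds for all $t\in[0,T]$, then $t\mapsto L(\chi_t,\lambda)$ is strictly decreasing on $[0,T]$. -/

import Mathlib

open MeasureTheory Set Filter
open scoped Topology Matrix

namespace LevelSetDescent

noncomputable section

/-- Data of a relaxed bi-material topology optimization problem in `ℝⁿ`: the state equation is
the discretized elastic problem with `N` nodal displacements and `p` strain components. -/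
structure DesignProblem (n N p : ℕ) where
  /-- design domain -/
  Ω : Set (EuclideanSpace ℝ (Fin n))
  /-- relaxation factor: the value of the characteristic function on the soft phase -/
  β : ℝ
  /-- contrast stiffness exponent -/
  m : ℝ
  /-- strain matrix, `ε(x) = B(x) d` -/
  B : EuclideanSpace ℝ (Fin n) → Matrix (Fin p) (Fin N) ℝ
  /-- constitutive matrix of the hard phase -/
  D : Matrix (Fin p) (Fin p) ℝ
  /-- external nodal forces -/
  f : Fin N → ℝ
  /-- cost density `G(χ(x), d, x)`, with `d` the vector of nodal displacements -/
  G : ℝ → (Fin N → ℝ) → EuclideanSpace ℝ (Fin n) → ℝ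
  /-- target volume of the hard phase -/
  V : ℝ

/-- Relaxed Heaviside function. The value at `0` is a convention (the hard phase is
`{ψ > 0}`, the soft phase its complement). -/
def relaxedHeaviside (β s : ℝ) : ℝ := if 0 < s then 1 else β

/-- `Δχ(x)`: the increment of the characteristic function when the phase at `x` is exchanged. -/
def phaseExchange {n : ℕ} (β : ℝ) (χ : EuclideanSpace ℝ (Fin n) → ℝ)
    (x : EuclideanSpace ℝ (Fin n)) : ℝ :=
  if χ x = 1 then -(1 - β) else 1 - β

/-- `χ + η`, where `η = Δχ` on the ball of radius `ε` around `y` and `η = 0` elsewhere. -/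
def exchangeOnBall {n : ℕ} (β : ℝ) (χ : EuclideanSpace ℝ (Fin n) → ℝ)
    (y : EuclideanSpace ℝ (Fin n)) (ε : ℝ) : EuclideanSpace ℝ (Fin n) → ℝ :=
  χ + (Metric.ball y ε).indicator (phaseExchange β χ)

/-- `r` is the relaxed topological derivative `(δJ(χ)/δχ)(y)`: the limit of the change of `J`
under phase exchange in a small ball around `y`, per unit of volume of the ball. -/
def HasRTD {n : ℕ} (β : ℝ) (J : (EuclideanSpace ℝ (Fin n) → ℝ) → ℝ)
    (χ : EuclideanSpace ℝ (Fin n) → ℝ) (y : EuclideanSpace ℝ (Fin n)) (r : ℝ) : Prop :=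
  Tendsto (fun ε : ℝ => (J (exchangeOnBall β χ y ε) - J χ) / volume.real (Metric.ball y ε))
    (𝓝[>] 0) (𝓝 r)

namespace DesignProblem

variable {n N p : ℕ}

/-- Standing assumptions on the data. -/
structure IsAdmissible (P : DesignProblem n N p) : Prop where
  isOpen : IsOpen P.Ω
  isBounded : Bornology.IsBounded P.Ω
  β_pos : 0 < P.β
  β_lt_one : P.β < 1
  posDef : P.D.PosDef
  aemeasurable_B : ∀ i j, AEMeasurable (fun x => P.B x i j) (volume.restrict P.Ω)
  bounded_B : ∃ M : ℝ, ∀ x ∈ P.Ω, ∀ i j, |P.B x i j| ≤ M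
  /-- the boundary conditions preclude rigid body motions -/
  no_rigid_motion : ∀ d : Fin N → ℝ, (∀ᵐ x ∂(volume.restrict P.Ω), P.B x *ᵥ d = 0) → d = 0
  aemeasurable_G : ∀ c ∈ ({P.β, 1} : Set ℝ), ∀ d,
    AEMeasurable (fun x => P.G c d x) (volume.restrict P.Ω)
  differentiable_G : ∀ c ∈ ({P.β, 1} : Set ℝ), ∀ x ∈ P.Ω, Differentiable ℝ fun d => P.G c d x
  dominated_G : ∀ c ∈ ({P.β, 1} : Set ℝ), ∀ R : ℝ,
    ∃ b : EuclideanSpace ℝ (Fin n) → ℝ, IntegrableOn b P.Ω volume ∧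
      ∀ x ∈ P.Ω, ∀ d : Fin N → ℝ, ‖d‖ ≤ R →
        |P.G c d x| ≤ b x ∧ ‖fderiv ℝ (fun e => P.G c e x) d‖ ≤ b x

/-- Stiffness matrix `K_χ = ∫_Ω χ^m Bᵀ D B`. -/
def stiffness (P : DesignProblem n N p) (χ : EuclideanSpace ℝ (Fin n) → ℝ) :
    Matrix (Fin N) (Fin N) ℝ :=
  Matrix.of fun i j => ∫ x in P.Ω, χ x ^ P.m * ((P.B x)ᵀ * P.D * P.B x) i j

/-- Nodal displacements `d_χ`, the solution of the state equation `K_χ d_χ = f`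
(for admissible data and every topology the matrix `K_χ` is positive definite). -/
def displacement (P : DesignProblem n N p) (χ : EuclideanSpace ℝ (Fin n) → ℝ) : Fin N → ℝ :=
  (P.stiffness χ)⁻¹ *ᵥ P.f

/-- Cost `J(χ) = ∫_Ω G(χ(x), d_χ, x) dx`. -/
def cost (P : DesignProblem n N p) (χ : EuclideanSpace ℝ (Fin n) → ℝ) : ℝ :=
  ∫ x in P.Ω, P.G (χ x) (P.displacement χ) x

/-- Volume constraint `C(χ) = |Ω⁺(χ)| - V`. -/
def volumeConstraint (P : DesignProblem n N p) (χ : EuclideanSpace ℝ (Fin n) → ℝ) : ℝ :=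
  volume.real {x ∈ P.Ω | χ x = 1} - P.V

/-- Lagrangian `L(χ, λ) = J(χ) + λ C(χ)`. -/
def lagrangian (P : DesignProblem n N p) (lam : ℝ) (χ : EuclideanSpace ℝ (Fin n) → ℝ) : ℝ :=
  P.cost χ + lam * P.volumeConstraint χ

/-- The topology `χ = H_β(φ)` defined by a level set function. -/
def topology (P : DesignProblem n N p) (φ : EuclideanSpace ℝ (Fin n) → ℝ) :
    EuclideanSpace ℝ (Fin n) → ℝ :=
  fun x => relaxedHeaviside P.β (φ x)

/-- The material interface `Γ = {x ∈ Ω | φ(x) = 0}`. -/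
def interface (P : DesignProblem n N p) (φ : EuclideanSpace ℝ (Fin n) → ℝ) :
    Set (EuclideanSpace ℝ (Fin n)) :=
  {x ∈ P.Ω | φ x = 0}

/-- `φ` is a classical solution on `[0, T]` of the level set evolution
`∂φ_t/∂t (x) = - k (1/Δχ_t(x)) (δL(χ_t, λ)/δχ)(x)`, `χ_t = H_β(φ_t)`. The equation is imposed in
both phases, where `Δχ_t` is defined; at the interface the velocity is determined by continuity. -/
structure IsLevelSetEvolution (P : DesignProblem n N p) (k lam T : ℝ)
    (φ : ℝ → EuclideanSpace ℝ (Fin n) → ℝ) : Prop where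
  regular : ∃ O : Set (ℝ × EuclideanSpace ℝ (Fin n)), IsOpen O ∧ Icc 0 T ×ˢ closure P.Ω ⊆ O ∧
    ContDiffOn ℝ 1 (fun q : ℝ × EuclideanSpace ℝ (Fin n) => φ q.1 q.2) O
  evolution : ∀ t ∈ Icc 0 T, ∀ x ∈ P.Ω, φ t x ≠ 0 →
    ∃ r : ℝ, HasRTD P.β (P.lagrangian lam) (P.topology (φ t)) x r ∧
      HasDerivAt (fun s => φ s x) (-k * (1 / phaseExchange P.β (P.topology (φ t)) x) * r) t

/-- The interface at time `t` is regular (`∇φ_t ≠ 0` on it, up to the boundary of the design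
domain, which it meets in a set of zero `(n-1)`-dimensional measure), and it is not stationary:
the velocity `∂φ_t/∂t` is not zero at all of its points. -/
structure RegularMovingInterface (P : DesignProblem n N p)
    (φ : ℝ → EuclideanSpace ℝ (Fin n) → ℝ) (t : ℝ) : Prop where
  gradient_ne_zero : ∀ x ∈ closure P.Ω, φ t x = 0 → gradient (φ t) x ≠ 0
  boundary_null : Measure.hausdorffMeasure ((n : ℝ) - 1) {x ∈ frontier P.Ω | φ t x = 0} = 0
  moving : ∃ x ∈ P.interface (φ t), deriv (fun s => φ s x) t ≠ 0

end DesignProblem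

end

end LevelSetDescent

open MeasureTheory Set Filter
open scoped Topology Matrix

namespace LevelSetDescent

noncomputable section

/-! Write `A_s` for the set in `Ω` where `φ_s > 0`. The Lagrangian depends on the topology only
through its hard phase `A`, and it is differentiable with respect to that set: there is an
integrable density `g` with `L(A) - L(A_t) = ∫_A g - ∫_{A_t} g + o(|A ∆ A_t|)`
(`exists_lagrangian_density`). The density collects the jump of the cost, the volume multiplier and
the sensitivity of the displacement.

Testing this expansion on `A_t` with a small ball added or removed, Lebesgue differentiation shows
that the topological derivative divided by `Δχ` equals `g / (1 - β)` almost everywhere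
(`ae_rtd_eq_density`). The evolution equation then says `g = -((1 - β) / k) v` a.e., with `v =
∂φ/∂t` at time `t`. So `g`, a priori only integrable, has a continuous version, for which traces on
the interface make sense.

By the implicit function theorem the interface moves with normal velocity `v / |∇φ|`. Hence `|A_s ∆
A_t| = O(|s - t|)`, which turns the error into `o(s - t)`, and `s ↦ ∫_{A_s} v` has at `t` the
derivative formally equal to `∫_Γ v² / |∇φ|`, positive as soon as `v ≠ 0` somewhere on `Γ`.
Therefore `L' = -((1 - β) / k) ∫_Γ v² / |∇φ| < 0`. The surface integral is never formed:
`exists_hasDerivAt_integral_positivePhase` yields a number `l`, assembled from local graphs by a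
partition of unity, and only its sign is needed. -/

open Asymptotics
open scoped symmDiff

/-! ### Integrals over varying sets -/

section SetIntegrals

variable {X : Type*} [MeasurableSpace X] {μ : Measure X}

open Classical in
theorem setIntegral_ite_eq_add {Ω A : Set X} {f g : X → ℝ} (hΩ : MeasurableSet Ω)
    (hA : MeasurableSet A)
    (hAΩ : A ⊆ Ω) (hf : IntegrableOn f Ω μ) (hg : IntegrableOn g Ω μ) :
    ∫ x in Ω, (if x ∈ A then f x else g x) ∂μ = ∫ x in Ω, g x ∂μ + ∫ x in A, (f x - g x) ∂μ := by
  have h1 : ∫ x in A, (f x - g x) ∂μ = ∫ x in Ω, A.indicator (fun x => f x - g x) x ∂μ := by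
    rw [setIntegral_indicator hA, inter_eq_self_of_subset_right hAΩ]
  have h2 : IntegrableOn (A.indicator fun x => f x - g x) Ω μ := (hf.sub hg).indicator hA
  rw [h1, ← integral_add hg h2]
  refine setIntegral_congr_fun hΩ fun x _ => ?_
  by_cases hx : x ∈ A <;> simp [hx]

/-- The contributions of `A ∩ B` cancel, leaving the integrals over the two one-sided differences.
-/
theorem abs_setIntegral_sub_le {Ω A B : Set X} {f b : X → ℝ} (hA : MeasurableSet A)
    (hB : MeasurableSet B) (hAΩ : A ⊆ Ω) (hBΩ : B ⊆ Ω) (hf : IntegrableOn f Ω μ)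
    (hb : IntegrableOn b Ω μ) (hfb : ∀ x ∈ Ω, |f x| ≤ b x) :
    |∫ x in A, f x ∂μ - ∫ x in B, f x ∂μ| ≤ ∫ x in A ∆ B, b x ∂μ := by
  have hfA := hf.mono_set hAΩ
  have hfB := hf.mono_set hBΩ
  have h1 := integral_inter_add_sdiff hB hfA
  have h2 := integral_inter_add_sdiff hA hfB
  rw [inter_comm] at h2
  have hbA : IntegrableOn b (A \ B) μ := hb.mono_set (sdiff_subset.trans hAΩ)
  have hbB : IntegrableOn b (B \ A) μ := hb.mono_set (sdiff_subset.trans hBΩ)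
  have h3 : ∫ x in A ∆ B, b x ∂μ = ∫ x in A \ B, b x ∂μ + ∫ x in B \ A, b x ∂μ :=
    setIntegral_union disjoint_sdiff_sdiff (hB.diff hA) hbA hbB
  have h4 : |∫ x in A \ B, f x ∂μ| ≤ ∫ x in A \ B, b x ∂μ := by
    rw [← Real.norm_eq_abs]
    exact norm_integral_le_of_norm_le hbA <| (ae_restrict_mem (hA.diff hB)).mono
      fun x hx => hfb x (hAΩ hx.1)
  have h5 : |∫ x in B \ A, f x ∂μ| ≤ ∫ x in B \ A, b x ∂μ := by
    rw [← Real.norm_eq_abs]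
    exact norm_integral_le_of_norm_le hbB <| (ae_restrict_mem (hB.diff hA)).mono
      fun x hx => hfb x (hBΩ hx.1)
  have h6 : ∫ x in A, f x ∂μ - ∫ x in B, f x ∂μ = ∫ x in A \ B, f x ∂μ - ∫ x in B \ A, f x ∂μ := by
    linarith
  rw [h6, h3]
  exact (abs_sub _ _).trans (add_le_add h4 h5)

/-- First order expansion of `e ↦ ∫_S H(e, x) dx` at `d`, uniform in `S` and with a
coefficient taken on a limit set. -/
theorem exists_isLittleO_setIntegral {V : Type*} [NormedAddCommGroup V] [NormedSpace ℝ V]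
    [FiniteDimensional ℝ V]
    {Ω : Set X} (hΩ : MeasurableSet Ω) {H : V → X → ℝ}
    (hmeas : ∀ d, AEMeasurable (H d) (μ.restrict Ω))
    (hdiff : ∀ x ∈ Ω, Differentiable ℝ fun d => H d x)
    (hdom : ∀ R : ℝ, ∃ b : X → ℝ, IntegrableOn b Ω μ ∧ ∀ x ∈ Ω, ∀ d : V, ‖d‖ ≤ R →
      |H d x| ≤ b x ∧ ‖fderiv ℝ (fun e => H e x) d‖ ≤ b x)
    {S₀ : Set X} (hS₀ : MeasurableSet S₀) (hS₀Ω : S₀ ⊆ Ω) (d₀ : V) :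
    ∃ ℓ : V →L[ℝ] ℝ, ∀ {ι : Type} {l : Filter ι} [l.IsCountablyGenerated] (S : ι → Set X)
      (d : ι → V), (∀ i, MeasurableSet (S i)) → (∀ i, S i ⊆ Ω) →
      Tendsto (fun i => μ (S i ∆ S₀)) l (𝓝 0) → Tendsto d l (𝓝 d₀) →
      (fun i => ∫ x in S i, H (d i) x ∂μ - ∫ x in S i, H d₀ x ∂μ - ℓ (d i - d₀))
        =o[l] fun i => d i - d₀ := by
  -- The radius `‖d₀‖ + 1` makes `b` bound the derivative on the whole unit ball around `d₀`, as the
  -- mean value inequality requires.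
  obtain ⟨b, hb, hbd⟩ := hdom (‖d₀‖ + 1)
  have hinteg : ∀ e : V, IntegrableOn (H e) Ω μ := fun e => by
    obtain ⟨b', hb', hbd'⟩ := hdom ‖e‖
    exact Integrable.mono' hb' (hmeas e).aestronglyMeasurable <|
      (ae_restrict_mem hΩ).mono fun x hx => (hbd' x hx e le_rfl).1
  -- Measurability of the derivative in `x` is not assumed; it is inherited from difference
  -- quotients with steps `1 / (k + 1)`.
  have hder_meas : ∀ h : V, AEMeasurable (fun x => fderiv ℝ (fun e => H e x) d₀ h)
      (μ.restrict Ω) := fun h => by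
    refine aemeasurable_of_tendsto_metrizable_ae (u := (atTop : Filter ℕ))
      (f := fun (k : ℕ) x => ((k : ℝ) + 1) * (H (d₀ + ((k : ℝ) + 1)⁻¹ • h) x - H d₀ x)) ?_ ?_
    · exact fun k => ((hmeas _).sub (hmeas _)).const_mul _
    · refine (ae_restrict_mem hΩ).mono fun x hx => ?_
      exact (hdiff x hx d₀).hasFDerivAt.lim_real h |>.comp
        (tendsto_atTop_add_const_right _ (1 : ℝ) tendsto_natCast_atTop_atTop)
  have hb0 : ∀ x ∈ Ω, ‖fderiv ℝ (fun e => H e x) d₀‖ ≤ b x := fun x hx =>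
    (hbd x hx d₀ (by linarith)).2
  have hder_int : ∀ h : V, IntegrableOn (fun x => fderiv ℝ (fun e => H e x) d₀ h) Ω μ := fun h =>
    Integrable.mono' (hb.mul_const ‖h‖) (hder_meas h).aestronglyMeasurable <|
      (ae_restrict_mem hΩ).mono fun x hx => (ContinuousLinearMap.le_opNorm _ _).trans
        (mul_le_mul_of_nonneg_right (hb0 x hx) (norm_nonneg _))
  let ℓ₀ : V →ₗ[ℝ] ℝ :=
    { toFun := fun h => ∫ x in S₀, fderiv ℝ (fun e => H e x) d₀ h ∂μ
      map_add' := fun h h' => by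
        simp only [map_add]
        exact integral_add ((hder_int h).mono_set hS₀Ω) ((hder_int h').mono_set hS₀Ω)
      map_smul' := fun c h => by
        simp only [map_smul, smul_eq_mul, RingHom.id_apply]
        exact integral_const_mul _ _ }
  refine ⟨LinearMap.toContinuousLinearMap ℓ₀, fun {ι l} _ S d hS hSΩ hlim hd => ?_⟩
  -- The normalised Taylor remainder: it tends to zero pointwise and is dominated by `2 b`. Where `d
  -- i = d₀` the inverse norm is `0`, hence so is `q`.
  let q : ι → X → ℝ := fun i x =>
    ‖d i - d₀‖⁻¹ * |H (d i) x - H d₀ x - fderiv ℝ (fun e => H e x) d₀ (d i - d₀)|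
  have hq : Tendsto (fun i => ∫ x in Ω, q i x ∂μ) l (𝓝 0) := by
    have hnear : ∀ᶠ i in l, ‖d i - d₀‖ < 1 := by
      have := hd.sub_const d₀
      rw [sub_self] at this
      simpa using this.norm.eventually (gt_mem_nhds (by simp))
    rw [show (0 : ℝ) = ∫ x in Ω, (0 : ℝ) ∂μ by simp]
    refine tendsto_integral_filter_of_dominated_convergence (fun x => 2 * b x)
      (Eventually.of_forall fun i => ?_) ?_ (hb.const_mul 2) ?_
    · exact ((continuous_abs.measurable.comp_aemeasurable
        (((hmeas _).sub (hmeas _)).sub (hder_meas _))).const_mul _).aestronglyMeasurable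
    · filter_upwards [hnear] with i hi
      refine (ae_restrict_mem hΩ).mono fun x hx => ?_
      have h1 : |H (d i) x - H d₀ x| ≤ b x * ‖d i - d₀‖ := by
        have := (convex_ball d₀ (1 : ℝ)).norm_image_sub_le_of_norm_fderiv_le (𝕜 := ℝ)
          (f := fun e => H e x) (C := b x) (x := d₀) (y := d i)
          (fun e _ => hdiff x hx e) (fun e he => (hbd x hx e ?_).2) (by simp)
          (by simpa [dist_eq_norm] using hi)
        · simpa using this
        · have : ‖e‖ ≤ ‖d₀‖ + ‖e - d₀‖ := by simpa using norm_add_le d₀ (e - d₀)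
          rw [Metric.mem_ball, dist_eq_norm] at he
          linarith
      have h2 : |fderiv ℝ (fun e => H e x) d₀ (d i - d₀)| ≤ b x * ‖d i - d₀‖ :=
        (ContinuousLinearMap.le_opNorm _ _).trans
          (mul_le_mul_of_nonneg_right (hb0 x hx) (norm_nonneg _))
      have h3 := (abs_sub (H (d i) x - H d₀ x) (fderiv ℝ (fun e => H e x) d₀ (d i - d₀))).trans
        (add_le_add h1 h2)
      have hbx : 0 ≤ b x := (norm_nonneg _).trans (hb0 x hx)
      rw [Real.norm_eq_abs, abs_of_nonneg (by positivity)]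
      rcases eq_or_ne (d i - d₀) 0 with h0 | h0
      · simp [q, h0]; positivity
      · have : 0 < ‖d i - d₀‖ := norm_pos_iff.2 h0
        rw [inv_mul_le_iff₀ this]
        linarith
    · refine (ae_restrict_mem hΩ).mono fun x hx => ?_
      have h1 := ((hdiff x hx d₀).hasFDerivAt.isLittleO.comp_tendsto hd)
      have h2 := h1.norm_norm.tendsto_div_nhds_zero
      refine h2.congr fun i => ?_
      simp [q, div_eq_inv_mul]
  have hbS : Tendsto (fun i => ∫ x in S i ∆ S₀, b x ∂μ) l (𝓝 0) := by
    have hsub : ∀ i, S i ∆ S₀ ⊆ Ω := fun i =>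
      symmDiff_subset_union.trans (union_subset (hSΩ i) hS₀Ω)
    have := hb.tendsto_setIntegral_nhds_zero (l := l) (s := fun i => S i ∆ S₀)
      (by
        refine hlim.congr fun i => ?_
        simp [Measure.restrict_apply ((hS i).symmDiff hS₀), inter_eq_self_of_subset_left (hsub i)])
    refine this.congr fun i => ?_
    rw [Measure.restrict_restrict ((hS i).symmDiff hS₀), inter_eq_self_of_subset_left (hsub i)]
  refine IsLittleO.of_bound fun c hc => ?_
  have hsum := hq.add hbS
  rw [add_zero] at hsum
  filter_upwards [hsum.eventually (gt_mem_nhds hc)] with i hi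
  have hqint : IntegrableOn (fun x => |H (d i) x - H d₀ x -
      fderiv ℝ (fun e => H e x) d₀ (d i - d₀)|) Ω μ :=
    (((hinteg _).sub (hinteg _)).sub (hder_int _)).abs
  -- The error splits into the Taylor remainder over `S i`, controlled by `q`, and the derivative
  -- integrated over the mismatch of `S i` and `S₀`, controlled by `b` over a set of vanishing
  -- measure.
  have e1 : ∫ x in S i, H (d i) x ∂μ - ∫ x in S i, H d₀ x ∂μ - ℓ₀ (d i - d₀) =
      ∫ x in S i, (H (d i) x - H d₀ x - fderiv ℝ (fun e => H e x) d₀ (d i - d₀)) ∂μ +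
      (∫ x in S i, fderiv ℝ (fun e => H e x) d₀ (d i - d₀) ∂μ -
        ∫ x in S₀, fderiv ℝ (fun e => H e x) d₀ (d i - d₀) ∂μ) := by
    have a1 := (hinteg (d i)).mono_set (hSΩ i)
    have a2 := (hinteg d₀).mono_set (hSΩ i)
    have a3 := (hder_int (d i - d₀)).mono_set (hSΩ i)
    have a4 : IntegrableOn (fun x => H (d i) x - H d₀ x) (S i) μ := a1.sub a2
    rw [integral_sub a4 a3, integral_sub a1 a2]
    change _ - _ - (∫ x in S₀, fderiv ℝ (fun e => H e x) d₀ (d i - d₀) ∂μ) = _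
    ring
  have e2 : |∫ x in S i, (H (d i) x - H d₀ x - fderiv ℝ (fun e => H e x) d₀ (d i - d₀)) ∂μ| ≤
      (∫ x in Ω, q i x ∂μ) * ‖d i - d₀‖ := by
    refine (abs_integral_le_integral_abs).trans ?_
    refine (setIntegral_mono_set hqint (ae_of_all _ fun x => abs_nonneg _)
      (hSΩ i).eventuallyLE).trans ?_
    rw [← integral_mul_const]
    refine le_of_eq (integral_congr_ae (ae_of_all _ fun x => ?_))
    rcases eq_or_ne (d i - d₀) 0 with h0 | h0
    · have : d i = d₀ := sub_eq_zero.1 h0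
      simp [this]
    · have : ‖d i - d₀‖ ≠ 0 := norm_ne_zero_iff.2 h0
      simp only [q]
      field_simp
  have e3 := abs_setIntegral_sub_le (hS i) hS₀ (hSΩ i) hS₀Ω (hder_int (d i - d₀))
    (hb.mul_const ‖d i - d₀‖) fun x hx => (ContinuousLinearMap.le_opNorm _ _).trans
        (mul_le_mul_of_nonneg_right (hb0 x hx) (norm_nonneg _))
  rw [integral_mul_const] at e3
  change ‖_ - ℓ₀ (d i - d₀)‖ ≤ _
  rw [e1, Real.norm_eq_abs]
  refine (abs_add_le _ _).trans ((add_le_add e2 e3).trans ?_)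
  rw [← add_mul]
  exact mul_le_mul_of_nonneg_right hi.le (norm_nonneg _)

end SetIntegrals

/-! ### State and Lagrangian as functions of the hard phase -/

open Classical in
/-- The topology whose hard phase is `A`. -/
def twoPhase {n : ℕ} (β : ℝ) (A : Set (EuclideanSpace ℝ (Fin n))) :
    EuclideanSpace ℝ (Fin n) → ℝ :=
  fun x => if x ∈ A then 1 else β

namespace DesignProblem

variable {n N p : ℕ}

/-- Density `Bᵀ D B` of the stiffness matrix of the hard phase. -/
def stiffnessDensity (P : DesignProblem n N p) (x : EuclideanSpace ℝ (Fin n)) :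
    Matrix (Fin N) (Fin N) ℝ :=
  (P.B x)ᵀ * P.D * P.B x

theorem stiffness_congr {P : DesignProblem n N p} (hP : P.IsAdmissible)
    {χ χ' : EuclideanSpace ℝ (Fin n) → ℝ} (h : EqOn χ χ' P.Ω) :
    P.stiffness χ = P.stiffness χ' := by
  ext i j
  exact setIntegral_congr_fun hP.isOpen.measurableSet fun x hx => by simp only [h hx]

/-- Allows a topology to be replaced by a `twoPhase` function, from which it may differ outside `Ω`.
-/
theorem lagrangian_congr {P : DesignProblem n N p} (hP : P.IsAdmissible) (lam : ℝ)
    {χ χ' : EuclideanSpace ℝ (Fin n) → ℝ} (h : EqOn χ χ' P.Ω) :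
    P.lagrangian lam χ = P.lagrangian lam χ' := by
  have h1 : P.displacement χ = P.displacement χ' := by
    rw [displacement, displacement, stiffness_congr hP h]
  have h2 : P.cost χ = P.cost χ' := by
    rw [cost, cost, h1]
    exact setIntegral_congr_fun hP.isOpen.measurableSet fun x hx => by simp only [h hx]
  have h3 : {x ∈ P.Ω | χ x = 1} = {x ∈ P.Ω | χ' x = 1} := by
    ext x
    exact and_congr_right fun hx => by rw [h hx]
  rw [lagrangian, lagrangian, h2, volumeConstraint, volumeConstraint, h3]

namespace IsAdmissible

variable {P : DesignProblem n N p}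

theorem volume_lt_top (hP : P.IsAdmissible) : volume P.Ω < ⊤ := hP.isBounded.measure_lt_top

theorem exists_stiffnessDensity_le (hP : P.IsAdmissible) :
    ∃ C : ℝ, 0 ≤ C ∧ ∀ x ∈ P.Ω, ∀ i j, |P.stiffnessDensity x i j| ≤ C := by
  obtain ⟨M, hM⟩ := hP.bounded_B
  have hM' : ∀ x ∈ P.Ω, ∀ i j, |P.B x i j| ≤ |M| := fun x hx i j =>
    (hM x hx i j).trans (le_abs_self M)
  refine ⟨∑ l, ∑ k, |M| * |P.D k l| * |M|, by positivity, fun x hx i j => ?_⟩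
  simp only [stiffnessDensity, Matrix.mul_apply, Matrix.transpose_apply, Finset.sum_mul]
  refine (Finset.abs_sum_le_sum_abs _ _).trans (Finset.sum_le_sum fun l _ => ?_)
  refine (Finset.abs_sum_le_sum_abs _ _).trans (Finset.sum_le_sum fun k _ => ?_)
  rw [abs_mul, abs_mul]
  have h1 := hM' x hx k i
  have h2 := hM' x hx l j
  gcongr

theorem aemeasurable_stiffnessDensity (hP : P.IsAdmissible) (i j : Fin N) :
    AEMeasurable (fun x => P.stiffnessDensity x i j) (volume.restrict P.Ω) := by
  simp only [stiffnessDensity, Matrix.mul_apply, Matrix.transpose_apply]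
  refine Finset.aemeasurable_fun_sum _ fun l _ => AEMeasurable.mul ?_ (hP.aemeasurable_B l j)
  exact Finset.aemeasurable_fun_sum _ fun k _ => (hP.aemeasurable_B k i).mul_const _

theorem integrableOn_stiffnessDensity (hP : P.IsAdmissible) (i j : Fin N) :
    IntegrableOn (fun x => P.stiffnessDensity x i j) P.Ω := by
  obtain ⟨C, -, hC⟩ := hP.exists_stiffnessDensity_le
  have : IntegrableOn (fun _ : EuclideanSpace ℝ (Fin n) => C) P.Ω :=
    integrableOn_const hP.volume_lt_top.ne
  exact Integrable.mono' this (hP.aemeasurable_stiffnessDensity i j).aestronglyMeasurable <|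
    (ae_restrict_mem hP.isOpen.measurableSet).mono fun x hx => hC x hx i j

/-- As `1 ^ m = 1`, the weight is affine in the indicator of `A`; increments of the stiffness matrix
are thus exact set integrals. -/
theorem stiffness_twoPhase (hP : P.IsAdmissible) {A : Set (EuclideanSpace ℝ (Fin n))}
    (hA : MeasurableSet A) (hAΩ : A ⊆ P.Ω) (i j : Fin N) :
    P.stiffness (twoPhase P.β A) i j = P.β ^ P.m * (∫ x in P.Ω, P.stiffnessDensity x i j) +
      (1 - P.β ^ P.m) * ∫ x in A, P.stiffnessDensity x i j := by
  have h := hP.integrableOn_stiffnessDensity i j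
  have := setIntegral_ite_eq_add hP.isOpen.measurableSet hA hAΩ h (h.const_mul (P.β ^ P.m))
  rw [integral_const_mul] at this
  rw [← integral_const_mul (1 - P.β ^ P.m)]
  simp only [sub_mul, one_mul]
  rw [← this]
  refine integral_congr_ae (ae_of_all _ fun x => ?_)
  by_cases hx : x ∈ A <;> simp [twoPhase, hx, stiffnessDensity]

theorem dotProduct_stiffnessDensity (P : DesignProblem n N p) (x : EuclideanSpace ℝ (Fin n))
    (d : Fin N → ℝ) :
    d ⬝ᵥ (P.stiffnessDensity x *ᵥ d) = (P.B x *ᵥ d) ⬝ᵥ (P.D *ᵥ (P.B x *ᵥ d)) := by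
  rw [stiffnessDensity, ← Matrix.mulVec_mulVec, ← Matrix.mulVec_mulVec, Matrix.dotProduct_mulVec,
    Matrix.vecMul_transpose]

/-- A kernel vector `d` has zero energy. The energy density is nonnegative with a positive weight,
so definiteness of `D` forces `B d = 0` a.e., a rigid motion. -/
theorem det_stiffness_twoPhase_ne_zero (hP : P.IsAdmissible)
    {A : Set (EuclideanSpace ℝ (Fin n))} (hA : MeasurableSet A) :
    (P.stiffness (twoPhase P.β A)).det ≠ 0 := by
  intro hdet
  obtain ⟨d, hd0, hd⟩ := Matrix.exists_mulVec_eq_zero_iff.2 hdet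
  refine hd0 (hP.no_rigid_motion d ?_)
  have hpos : ∀ x, 0 < twoPhase P.β A x ^ P.m := fun x => by
    refine Real.rpow_pos_of_pos ?_ _
    unfold twoPhase
    split_ifs
    exacts [one_pos, hP.β_pos]
  have hmeas : Measurable fun x => twoPhase P.β A x ^ P.m := by
    have : Measurable (twoPhase P.β A) := Measurable.ite hA measurable_const measurable_const
    exact this.pow_const _
  have hle : ∀ x, |twoPhase P.β A x ^ P.m| ≤ max 1 (P.β ^ P.m) := fun x => by
    rw [abs_of_pos (hpos x)]
    by_cases hx : x ∈ A <;> simp [twoPhase, hx]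
  have hinteg : ∀ i j, IntegrableOn
      (fun x => twoPhase P.β A x ^ P.m * P.stiffnessDensity x i j) P.Ω := fun i j =>
    (hP.integrableOn_stiffnessDensity i j).bdd_mul hmeas.aestronglyMeasurable
      (ae_of_all _ hle)
  have hquad : d ⬝ᵥ (P.stiffness (twoPhase P.β A) *ᵥ d) =
      ∫ x in P.Ω, twoPhase P.β A x ^ P.m * (d ⬝ᵥ (P.stiffnessDensity x *ᵥ d)) := by
    have e1 : ∀ x, twoPhase P.β A x ^ P.m * (d ⬝ᵥ (P.stiffnessDensity x *ᵥ d)) =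
        ∑ i, ∑ j, d i * d j * (twoPhase P.β A x ^ P.m * P.stiffnessDensity x i j) := fun x => by
      simp only [dotProduct, Matrix.mulVec, Finset.mul_sum]
      exact Finset.sum_congr rfl fun i _ => Finset.sum_congr rfl fun j _ => by ring
    simp only [e1]
    rw [integral_finsetSum _ fun i _ => integrable_finsetSum _ fun j _ =>
      (hinteg i j).const_mul _]
    simp only [dotProduct, Matrix.mulVec, Finset.mul_sum]
    refine Finset.sum_congr rfl fun i _ => ?_
    rw [integral_finsetSum _ fun j _ => (hinteg i j).const_mul _]
    refine Finset.sum_congr rfl fun j _ => ?_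
    rw [integral_const_mul]
    simp only [stiffness, Matrix.of_apply, stiffnessDensity]
    ring
  have hnn : ∀ x, 0 ≤ twoPhase P.β A x ^ P.m * (d ⬝ᵥ (P.stiffnessDensity x *ᵥ d)) := fun x => by
    rw [dotProduct_stiffnessDensity]
    exact mul_nonneg (hpos x).le (hP.posDef.posSemidef.dotProduct_mulVec_nonneg _)
  have hI : IntegrableOn
      (fun x => twoPhase P.β A x ^ P.m * (d ⬝ᵥ (P.stiffnessDensity x *ᵥ d))) P.Ω := by
    simp only [dotProduct, Matrix.mulVec, Finset.mul_sum]
    refine integrable_finsetSum _ fun i _ => integrable_finsetSum _ fun j _ => ?_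
    refine ((hinteg i j).const_mul (d i * d j)).congr (ae_of_all _ fun x => ?_)
    simp only
    ring
  rw [hd, dotProduct_zero] at hquad
  have hzero := (integral_eq_zero_iff_of_nonneg hnn hI).1 hquad.symm
  filter_upwards [hzero] with x hx
  by_contra hne
  have h1 := hP.posDef.dotProduct_mulVec_pos hne
  have h2 := (mul_eq_zero.1 hx).resolve_left (hpos x).ne'
  rw [dotProduct_stiffnessDensity] at h2
  simp only [star_trivial] at h1
  exact h1.ne' h2

end IsAdmissible

end DesignProblem

namespace DesignProblem

variable {n N p : ℕ}

namespace IsAdmissible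

variable {P : DesignProblem n N p}

theorem integrableOn_G (hP : P.IsAdmissible) {c : ℝ} (hc : c ∈ ({P.β, 1} : Set ℝ))
    (d : Fin N → ℝ) : IntegrableOn (fun x => P.G c d x) P.Ω := by
  obtain ⟨b, hb, hbd⟩ := hP.dominated_G c hc ‖d‖
  exact Integrable.mono' hb (hP.aemeasurable_G c hc d).aestronglyMeasurable <|
    (ae_restrict_mem hP.isOpen.measurableSet).mono fun x hx => (hbd x hx d le_rfl).1

/-- Each integrand here has a fixed first argument `1` or `β`, so that only the domain and the
displacement vary and the first order expansion applies term by term. -/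
theorem lagrangian_twoPhase (hP : P.IsAdmissible) (lam : ℝ)
    {A : Set (EuclideanSpace ℝ (Fin n))} (hA : MeasurableSet A) (hAΩ : A ⊆ P.Ω) :
    P.lagrangian lam (twoPhase P.β A) =
      (∫ x in P.Ω, P.G P.β (P.displacement (twoPhase P.β A)) x) +
      ((∫ x in A, P.G 1 (P.displacement (twoPhase P.β A)) x) -
        ∫ x in A, P.G P.β (P.displacement (twoPhase P.β A)) x) +
      lam * ((∫ _ in A, (1 : ℝ)) - P.V) := by
  have hβ := hP.integrableOn_G (c := P.β) (by simp) (P.displacement (twoPhase P.β A))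
  have h1 := hP.integrableOn_G (c := 1) (by simp) (P.displacement (twoPhase P.β A))
  have hset : {x ∈ P.Ω | twoPhase P.β A x = 1} = A := by
    ext x
    have := hP.β_lt_one.ne
    by_cases hx : x ∈ A
    · simp [twoPhase, hx, hAΩ hx]
    · simp [twoPhase, hx, this]
  have hvol : ∫ _ in A, (1 : ℝ) = volume.real A := by simp
  rw [lagrangian, volumeConstraint, hset, hvol, cost,
    ← integral_sub (h1.mono_set hAΩ) (hβ.mono_set hAΩ),
    ← setIntegral_ite_eq_add hP.isOpen.measurableSet hA hAΩ h1 hβ]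
  congr 1
  refine integral_congr_ae (ae_of_all _ fun x => ?_)
  by_cases hx : x ∈ A <;> simp [twoPhase, hx]

theorem isBigO_stiffness_twoPhase_sub (hP : P.IsAdmissible) {ι : Type} {l : Filter ι}
    {A₀ : Set (EuclideanSpace ℝ (Fin n))} {A : ι → Set (EuclideanSpace ℝ (Fin n))}
    (hA₀ : MeasurableSet A₀) (hA₀Ω : A₀ ⊆ P.Ω) (hA : ∀ i, MeasurableSet (A i))
    (hAΩ : ∀ i, A i ⊆ P.Ω) (i j : Fin N) :
    (fun a => P.stiffness (twoPhase P.β (A a)) i j - P.stiffness (twoPhase P.β A₀) i j)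
      =O[l] fun a => volume.real (A a ∆ A₀) := by
  obtain ⟨C, hC0, hC⟩ := hP.exists_stiffnessDensity_le
  refine IsBigO.of_bound (|1 - P.β ^ P.m| * C) (Eventually.of_forall fun a => ?_)
  have h1 := abs_setIntegral_sub_le (hA a) hA₀ (hAΩ a) hA₀Ω
    (hP.integrableOn_stiffnessDensity i j) (b := fun _ => C)
    (integrableOn_const hP.volume_lt_top.ne) (fun x hx => hC x hx i j)
  rw [setIntegral_const, smul_eq_mul] at h1
  rw [hP.stiffness_twoPhase (hA a) (hAΩ a), hP.stiffness_twoPhase hA₀ hA₀Ω, Real.norm_eq_abs,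
    Real.norm_eq_abs, abs_of_nonneg measureReal_nonneg, add_sub_add_left_eq_sub, ← mul_sub,
    abs_mul, mul_assoc, mul_comm C]
  exact mul_le_mul_of_nonneg_left h1 (abs_nonneg _)

theorem mulVec_displacement_twoPhase (hP : P.IsAdmissible)
    {A : Set (EuclideanSpace ℝ (Fin n))} (hA : MeasurableSet A) :
    P.stiffness (twoPhase P.β A) *ᵥ P.displacement (twoPhase P.β A) = P.f := by
  rw [displacement, Matrix.mulVec_mulVec, Matrix.mul_nonsing_inv _
    (hP.det_stiffness_twoPhase_ne_zero hA).isUnit, Matrix.one_mulVec]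

/-- Everything follows from the exact identity `d - d₀ = -K₀⁻¹ (K - K₀) d`, where `K - K₀ = O(|A ∆
A₀|)`. Continuity of matrix inversion bounds `d`, which gives the linear estimate; replacing `d` by
`d₀` on the right then costs only `O(|A ∆ A₀|²)`. -/
theorem displacement_expansion (hP : P.IsAdmissible) {ι : Type} {l : Filter ι}
    {A₀ : Set (EuclideanSpace ℝ (Fin n))} {A : ι → Set (EuclideanSpace ℝ (Fin n))}
    (hA₀ : MeasurableSet A₀) (hA₀Ω : A₀ ⊆ P.Ω) (hA : ∀ i, MeasurableSet (A i))
    (hAΩ : ∀ i, A i ⊆ P.Ω) (hlim : Tendsto (fun i => volume.real (A i ∆ A₀)) l (𝓝 0)) :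
    Tendsto (fun i => P.displacement (twoPhase P.β (A i))) l
      (𝓝 (P.displacement (twoPhase P.β A₀))) ∧
    (fun i => P.displacement (twoPhase P.β (A i)) - P.displacement (twoPhase P.β A₀))
      =O[l] (fun i => volume.real (A i ∆ A₀)) ∧
    (fun i => P.displacement (twoPhase P.β (A i)) - P.displacement (twoPhase P.β A₀) +
      (P.stiffness (twoPhase P.β A₀))⁻¹ *ᵥ
        ((P.stiffness (twoPhase P.β (A i)) - P.stiffness (twoPhase P.β A₀)) *ᵥ
          P.displacement (twoPhase P.β A₀))) =o[l] fun i => volume.real (A i ∆ A₀) := by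
  set K := fun i => P.stiffness (twoPhase P.β (A i)) with hK
  set K₀ := P.stiffness (twoPhase P.β A₀) with hK₀
  set d := fun i => P.displacement (twoPhase P.β (A i)) with hd
  set d₀ := P.displacement (twoPhase P.β A₀) with hd₀
  have hdet₀ : K₀.det ≠ 0 := hP.det_stiffness_twoPhase_ne_zero hA₀
  have hKO : ∀ i j, (fun a => (K a - K₀) i j) =O[l] fun a => volume.real (A a ∆ A₀) :=
    fun i j => hP.isBigO_stiffness_twoPhase_sub hA₀ hA₀Ω hA hAΩ i j
  have hKlim : Tendsto K l (𝓝 K₀) := by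
    refine tendsto_pi_nhds.2 fun i => tendsto_pi_nhds.2 fun j => ?_
    exact tendsto_sub_nhds_zero_iff.1 ((hKO i j).trans_tendsto hlim)
  have hdlim : Tendsto d l (𝓝 d₀) := by
    have hinv : ContinuousAt (fun M : Matrix (Fin N) (Fin N) ℝ => M⁻¹ *ᵥ P.f) K₀ := by
      have h1 : ContinuousAt (fun M : Matrix (Fin N) (Fin N) ℝ => M.det⁻¹) K₀ :=
        (Continuous.matrix_det continuous_id).continuousAt.inv₀ hdet₀
      have h2 : ContinuousAt (fun M : Matrix (Fin N) (Fin N) ℝ => M.adjugate *ᵥ P.f) K₀ :=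
        ((Continuous.matrix_adjugate continuous_id).matrix_mulVec
          continuous_const).continuousAt
      refine (h1.smul h2).congr (Eventually.of_forall fun M => ?_)
      simp [Matrix.inv_def, Matrix.smul_mulVec]
    exact hinv.tendsto.comp hKlim
  have key : ∀ a, d a - d₀ = -(K₀⁻¹ *ᵥ ((K a - K₀) *ᵥ d a)) := fun a => by
    have e1 : K a *ᵥ d a = P.f := hP.mulVec_displacement_twoPhase (hA a)
    have e3 : K₀⁻¹ *ᵥ (K₀ *ᵥ d a) = d a := by
      rw [Matrix.mulVec_mulVec, Matrix.nonsing_inv_mul _ hdet₀.isUnit, Matrix.one_mulVec]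
    rw [Matrix.sub_mulVec, Matrix.mulVec_sub, e1, e3]
    simp only [hd₀, displacement, ← hK₀]
    abel
  have hlin : ∀ (v : ι → Fin N → ℝ) (w : ι → ℝ), (∀ j, (fun a => v a j) =O[l] w) →
      (fun a => K₀⁻¹ *ᵥ ((K a - K₀) *ᵥ v a)) =O[l] fun a => volume.real (A a ∆ A₀) * w a := by
    intro v w hv
    refine isBigO_pi.2 fun i => ?_
    simp only [Matrix.mulVec, dotProduct]
    refine IsBigO.fun_sum fun j _ => IsBigO.const_mul_left (IsBigO.fun_sum fun k _ => ?_) _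
    exact (hKO j k).mul (hv k)
  have hbig : (fun a => d a - d₀) =O[l] fun a => volume.real (A a ∆ A₀) := by
    have := hlin d (fun _ => (1 : ℝ)) fun j =>
      (((continuous_apply j).tendsto d₀).comp hdlim).isBigO_one ℝ
    simp only [mul_one] at this
    exact (this.neg_left).congr_left fun a => (key a).symm
  refine ⟨hdlim, hbig, ?_⟩
  have h2 := hlin (fun a => d a - d₀) (fun a => volume.real (A a ∆ A₀)) fun j =>
    isBigO_pi.1 hbig j
  have h3 : (fun a => volume.real (A a ∆ A₀) * volume.real (A a ∆ A₀)) =o[l]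
      fun a => volume.real (A a ∆ A₀) := by
    simpa using ((isLittleO_one_iff ℝ).2 hlim).mul_isBigO
      (isBigO_refl (fun a => volume.real (A a ∆ A₀)) l)
  refine (h2.trans_isLittleO h3).neg_left.congr_left fun a => ?_
  change _ = d a - d₀ + K₀⁻¹ *ᵥ ((K a - K₀) *ᵥ d₀)
  rw [Matrix.mulVec_sub, Matrix.mulVec_sub, key a]
  abel

/-- Differentiability of the Lagrangian with respect to the hard phase: the increment is, up to
`o(|A ∆ A₀|)`, the increment of the integral of a fixed integrable density. -/
theorem exists_lagrangian_density (hP : P.IsAdmissible) (lam : ℝ)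
    {A₀ : Set (EuclideanSpace ℝ (Fin n))} (hA₀ : MeasurableSet A₀) (hA₀Ω : A₀ ⊆ P.Ω) :
    ∃ g : EuclideanSpace ℝ (Fin n) → ℝ, IntegrableOn g P.Ω ∧
      ∀ {ι : Type} {l : Filter ι} [l.IsCountablyGenerated]
        (A : ι → Set (EuclideanSpace ℝ (Fin n))), (∀ i, MeasurableSet (A i)) →
        (∀ i, A i ⊆ P.Ω) → Tendsto (fun i => volume.real (A i ∆ A₀)) l (𝓝 0) →
        (fun i => P.lagrangian lam (twoPhase P.β (A i)) - P.lagrangian lam (twoPhase P.β A₀) -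
          ((∫ x in A i, g x) - ∫ x in A₀, g x)) =o[l] fun i => volume.real (A i ∆ A₀) := by
  have hΩ := hP.isOpen.measurableSet
  set d₀ := P.displacement (twoPhase P.β A₀) with hd₀
  set K₀ := P.stiffness (twoPhase P.β A₀) with hK₀
  have hβm : P.β ∈ ({P.β, 1} : Set ℝ) := by simp
  have h1m : (1 : ℝ) ∈ ({P.β, 1} : Set ℝ) := by simp
  have hexp : ∀ c ∈ ({P.β, 1} : Set ℝ), ∀ S₀ : Set (EuclideanSpace ℝ (Fin n)),
      MeasurableSet S₀ → S₀ ⊆ P.Ω → _ := fun c hc S₀ hS₀ hS₀Ω =>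
    exists_isLittleO_setIntegral (μ := volume) hΩ (H := P.G c) (hP.aemeasurable_G c hc)
      (hP.differentiable_G c hc) (hP.dominated_G c hc) hS₀ hS₀Ω d₀
  -- The three cost integrals, over the fixed set `Ω` and twice over the varying phase; `ℓ` is the
  -- resulting derivative of the cost in the displacement with the phase frozen.
  obtain ⟨ℓ₁, h₁⟩ := hexp P.β hβm P.Ω hΩ subset_rfl
  obtain ⟨ℓ₂, h₂⟩ := hexp 1 h1m A₀ hA₀ hA₀Ω
  obtain ⟨ℓ₃, h₃⟩ := hexp P.β hβm A₀ hA₀ hA₀Ω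
  set ℓ := ℓ₁ + (ℓ₂ - ℓ₃) with hℓ
  -- The effect of a stiffness increment `M` on the cost is linear in `M`. Its coefficients `c` play
  -- the role of the adjoint state and turn the sensitivity of the displacement into the integral of
  -- the density `q` below.
  obtain ⟨c, hc⟩ : ∃ c : Fin N → Fin N → ℝ, ∀ M : Matrix (Fin N) (Fin N) ℝ,
      ℓ (K₀⁻¹ *ᵥ (M *ᵥ d₀)) = ∑ i, ∑ j, c i j * M i j := by
    refine ⟨fun i j => ℓ (K₀⁻¹ *ᵥ (Matrix.single i j (1 : ℝ) *ᵥ d₀)), fun M => ?_⟩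
    let Λ : Matrix (Fin N) (Fin N) ℝ →ₗ[ℝ] ℝ :=
      { toFun := fun M => ℓ (K₀⁻¹ *ᵥ (M *ᵥ d₀))
        map_add' := fun M M' => by rw [Matrix.add_mulVec, Matrix.mulVec_add, map_add]
        map_smul' := fun r M => by
          rw [Matrix.smul_mulVec, Matrix.mulVec_smul, map_smul, RingHom.id_apply] }
    change Λ M = ∑ i, ∑ j, Λ (Matrix.single i j 1) * M i j
    conv_lhs => rw [Matrix.matrix_eq_sum_single M]
    simp only [map_sum]
    refine Finset.sum_congr rfl fun i _ => Finset.sum_congr rfl fun j _ => ?_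
    rw [← mul_one (M i j), ← smul_eq_mul (M i j) 1, ← Matrix.smul_single, map_smul]
    simp [mul_comm]
  let q : EuclideanSpace ℝ (Fin n) → ℝ := fun x =>
    ∑ i, ∑ j, (1 - P.β ^ P.m) * c i j * P.stiffnessDensity x i j
  have hq : IntegrableOn q P.Ω := integrable_finsetSum _ fun i _ => integrable_finsetSum _
    fun j _ => (hP.integrableOn_stiffnessDensity i j).const_mul _
  have hG1 := hP.integrableOn_G h1m d₀
  have hGβ := hP.integrableOn_G hβm d₀
  have hone : IntegrableOn (fun _ : EuclideanSpace ℝ (Fin n) => (1 : ℝ)) P.Ω :=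
    integrableOn_const hP.volume_lt_top.ne
  have hqS : ∀ S : Set (EuclideanSpace ℝ (Fin n)), S ⊆ P.Ω → ∫ x in S, q x =
      ∑ i, ∑ j, (1 - P.β ^ P.m) * c i j * ∫ x in S, P.stiffnessDensity x i j := fun S hS => by
    have hi : ∀ i j, IntegrableOn (fun x => (1 - P.β ^ P.m) * c i j * P.stiffnessDensity x i j) S :=
      fun i j => ((hP.integrableOn_stiffnessDensity i j).mono_set hS).const_mul _
    simp only [q]
    rw [integral_finsetSum _ fun i _ => integrable_finsetSum _ fun j _ => hi i j]
    refine Finset.sum_congr rfl fun i _ => ?_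
    rw [integral_finsetSum _ fun j _ => hi i j]
    exact Finset.sum_congr rfl fun j _ => integral_const_mul _ _
  refine ⟨fun x => P.G 1 d₀ x - P.G P.β d₀ x + lam * 1 - q x,
    ((hG1.sub hGβ).add (hone.const_mul lam)).sub hq, fun {ι l} _ A hA hAΩ hlim => ?_⟩
  have hgS : ∀ S : Set (EuclideanSpace ℝ (Fin n)), S ⊆ P.Ω →
      ∫ x in S, (P.G 1 d₀ x - P.G P.β d₀ x + lam * 1 - q x) =
      (∫ x in S, P.G 1 d₀ x) - (∫ x in S, P.G P.β d₀ x) + lam * (∫ _ in S, (1 : ℝ)) -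
        ∫ x in S, q x := fun S hS => by
    have a1 : IntegrableOn (fun x => P.G 1 d₀ x) S := hG1.mono_set hS
    have a2 : IntegrableOn (fun x => P.G P.β d₀ x) S := hGβ.mono_set hS
    have a3 : IntegrableOn (fun _ : EuclideanSpace ℝ (Fin n) => lam * (1 : ℝ)) S :=
      (hone.mono_set hS).const_mul lam
    have a4 : IntegrableOn (fun x => P.G 1 d₀ x - P.G P.β d₀ x) S := a1.sub a2
    have a5 : IntegrableOn (fun x => P.G 1 d₀ x - P.G P.β d₀ x + lam * 1) S := a4.add a3
    rw [integral_sub a5 (hq.mono_set hS), integral_add a4 a3, integral_sub a1 a2,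
      integral_const_mul]
  obtain ⟨hdlim, hdO, hdo⟩ := hP.displacement_expansion hA₀ hA₀Ω hA hAΩ hlim
  have hlim' : Tendsto (fun i => volume (A i ∆ A₀)) l (𝓝 0) := by
    have hfin : ∀ i, volume (A i ∆ A₀) ≠ ⊤ := fun i =>
      (lt_of_le_of_lt (measure_mono (symmDiff_subset_union.trans
        (union_subset (hAΩ i) hA₀Ω))) hP.volume_lt_top).ne
    refine (ENNReal.tendsto_toReal_iff hfin ENNReal.zero_ne_top).1 ?_
    simpa [Measure.real] using hlim
  have r₁ := h₁ (fun _ : ι => P.Ω) _ (fun _ => hΩ) (fun _ => subset_rfl)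
    (by simp [tendsto_const_nhds]) hdlim
  have r₂ := h₂ A _ hA hAΩ hlim' hdlim
  have r₃ := h₃ A _ hA hAΩ hlim' hdlim
  -- Total error: the remainders of the cost integrals, which are `o(d - d₀)`, plus `ℓ` applied to
  -- the remainder of the displacement.
  have r := ((r₁.add (r₂.sub r₃)).trans_isBigO hdO).add
    ((ℓ.isBigO_comp (fun i => P.displacement (twoPhase P.β (A i)) - d₀ + K₀⁻¹ *ᵥ
      ((P.stiffness (twoPhase P.β (A i)) - K₀) *ᵥ d₀)) l).trans_isLittleO hdo)
  refine r.congr_left fun i => ?_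
  rw [hP.lagrangian_twoPhase lam (hA i) (hAΩ i), hP.lagrangian_twoPhase lam hA₀ hA₀Ω,
    hgS _ (hAΩ i), hgS _ hA₀Ω, map_add, hc]
  have hM : ∑ a, ∑ b, c a b * (P.stiffness (twoPhase P.β (A i)) - K₀) a b =
      (∫ x in A i, q x) - ∫ x in A₀, q x := by
    rw [hqS _ (hAΩ i), hqS _ hA₀Ω, ← Finset.sum_sub_distrib]
    refine Finset.sum_congr rfl fun a _ => ?_
    rw [← Finset.sum_sub_distrib]
    refine Finset.sum_congr rfl fun b _ => ?_
    rw [Matrix.sub_apply, hP.stiffness_twoPhase (hA i) (hAΩ i), hK₀,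
      hP.stiffness_twoPhase hA₀ hA₀Ω]
    ring
  rw [hM, hℓ]
  simp only [add_apply, sub_apply, ← hd₀]
  ring

end IsAdmissible

end DesignProblem

/-! ### The zero set as a moving graph -/

/-- In the box `ball y₀ r × (a, b)` and for times in `ball t r`, the region `{Φ > 0}` is the
region above the graph of `ψ`, which moves with velocity proportional to `-∂Φ/∂t`. -/
structure IsLocalGraph {F : Type*} [NormedAddCommGroup F] (Φ : (ℝ × F) × ℝ → ℝ) (t : ℝ) (y₀ : F)
    (ψ : ℝ × F → ℝ) (K r a b : ℝ) : Prop where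
  r_pos : 0 < r
  K_nonneg : 0 ≤ K
  mem : ∀ s ∈ Metric.ball t r, ∀ y ∈ Metric.ball y₀ r, ψ (s, y) ∈ Ioo a b
  lip : ∀ s ∈ Metric.ball t r, ∀ y ∈ Metric.ball y₀ r, |ψ (s, y) - ψ (t, y)| ≤ K * |s - t|
  pos_iff : ∀ s ∈ Metric.ball t r, ∀ y ∈ Metric.ball y₀ r, ∀ u ∈ Ioo a b,
    (0 < Φ ((s, y), u) ↔ ψ (s, y) < u)
  zero_iff : ∀ s ∈ Metric.ball t r, ∀ y ∈ Metric.ball y₀ r, ∀ u ∈ Ioo a b,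
    (Φ ((s, y), u) = 0 ↔ u = ψ (s, y))
  cont : ContinuousOn (fun y => ψ (t, y)) (Metric.ball y₀ r)
  velocity : ∀ y ∈ Metric.ball y₀ r, ∃ c > 0, HasDerivAt (fun s => ψ (s, y))
    (-(c * deriv (fun s => Φ ((s, y), ψ (t, y))) t)) t

/-- The implicit function theorem supplies a `C¹`, hence locally Lipschitz, `ψ`. Positivity of the
vertical derivative persists nearby, so `Φ` is strictly increasing on vertical segments and its sign
is decided by the position relative to the graph. Differentiating `Φ(s, y, ψ(s, y)) = 0` in `s`
gives the velocity, with `c` the inverse of the vertical derivative. -/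
theorem exists_isLocalGraph {F : Type*} [NormedAddCommGroup F] [NormedSpace ℝ F]
    [CompleteSpace F] {Φ : (ℝ × F) × ℝ → ℝ} {t : ℝ} {y₀ : F} {u₀ : ℝ}
    (hΦ : ContDiffAt ℝ 1 Φ ((t, y₀), u₀)) (h0 : Φ ((t, y₀), u₀) = 0)
    (hpos : 0 < fderiv ℝ Φ ((t, y₀), u₀) (0, 1)) :
    ∃ (ψ : ℝ × F → ℝ) (K r a b : ℝ), u₀ ∈ Ioo a b ∧ IsLocalGraph Φ t y₀ ψ K r a b := by
  have hinv : (fderiv ℝ Φ ((t, y₀), u₀) ∘L .inr ℝ (ℝ × F) ℝ).IsInvertible := by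
    set c := fderiv ℝ Φ ((t, y₀), u₀) (0, 1) with hc
    refine ⟨ContinuousLinearEquiv.unitsEquivAut ℝ (Units.mk0 c hpos.ne'), ?_⟩
    ext
    simp [hc]
  set ψ := hΦ.implicitFunction one_ne_zero hinv with hψ
  have hψC : ContDiffAt ℝ 1 ψ (t, y₀) := hΦ.contDiffAt_implicitFunction one_ne_zero hinv
  have hψ0 : ψ (t, y₀) = u₀ := hΦ.implicitFunction_apply_self one_ne_zero hinv
  have hψeq : ∀ᶠ q in 𝓝 (t, y₀), Φ (q, ψ q) = 0 := by
    have := hΦ.eventually_apply_implicitFunction one_ne_zero hinv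
    rwa [h0] at this
  have hgood : ∀ᶠ q in 𝓝 ((t, y₀), u₀), ContDiffAt ℝ 1 Φ q ∧ 0 < fderiv ℝ Φ q (0, 1) := by
    refine (hΦ.eventually (by simp)).and ?_
    have : ContinuousAt (fun q => fderiv ℝ Φ q (0, 1)) ((t, y₀), u₀) :=
      (hΦ.continuousAt_fderiv one_ne_zero).clm_apply continuousAt_const
    exact this.eventually (lt_mem_nhds hpos)
  obtain ⟨ρ, hρ, hball⟩ := Metric.eventually_nhds_iff_ball.1 hgood
  obtain ⟨K, S, hS, hK⟩ := hψC.exists_lipschitzOnWith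
  have hψmem : ∀ᶠ q in 𝓝 (t, y₀), ψ q ∈ Ioo (u₀ - ρ) (u₀ + ρ) := by
    refine hψC.continuousAt.eventually (Ioo_mem_nhds ?_ ?_) <;> rw [hψ0] <;> linarith
  obtain ⟨r', hr', hq⟩ := Metric.eventually_nhds_iff_ball.1
    ((hψmem.and hψeq).and ((hψC.eventually (by simp)).and (eventually_mem_set.2 hS)))
  -- `r'` is the range of validity of the properties of `ψ`, and `ρ` that of the regularity and
  -- monotonicity of `Φ`.
  set r := min r' ρ with hr
  have hrr' : r ≤ r' := min_le_left _ _
  have hrpos : 0 < r := lt_min hr' hρ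
  have hmemq : ∀ s ∈ Metric.ball t r, ∀ y ∈ Metric.ball y₀ r,
      (s, y) ∈ Metric.ball (t, y₀) r' := fun s hs y hy => by
    rw [← ball_prod_same]
    exact ⟨Metric.ball_subset_ball hrr' hs, Metric.ball_subset_ball hrr' hy⟩
  have hmemp : ∀ s ∈ Metric.ball t r, ∀ y ∈ Metric.ball y₀ r, ∀ u ∈ Ioo (u₀ - ρ) (u₀ + ρ),
      ((s, y), u) ∈ Metric.ball ((t, y₀), u₀) ρ := fun s hs y hy u hu => by
    rw [← ball_prod_same, ← ball_prod_same, Real.ball_eq_Ioo u₀]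
    exact ⟨⟨Metric.ball_subset_ball (min_le_right _ _) hs,
      Metric.ball_subset_ball (min_le_right _ _) hy⟩, hu⟩
  have htr : t ∈ Metric.ball t r := Metric.mem_ball_self hrpos
  have hmono : ∀ s ∈ Metric.ball t r, ∀ y ∈ Metric.ball y₀ r,
      StrictMonoOn (fun u => Φ ((s, y), u)) (Ioo (u₀ - ρ) (u₀ + ρ)) := fun s hs y hy => by
    have hd : ∀ u ∈ Ioo (u₀ - ρ) (u₀ + ρ),
        HasDerivAt (fun u => Φ ((s, y), u)) (fderiv ℝ Φ ((s, y), u) (0, 1)) u := fun u hu => by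
      have h1 := ((hball _ (hmemp s hs y hy u hu)).1.differentiableAt one_ne_zero).hasFDerivAt
      have h2 : HasDerivAt (fun u : ℝ => ((s, y), u)) ((0 : ℝ × F), (1 : ℝ)) u :=
        (hasDerivAt_const u (s, y)).prodMk (hasDerivAt_id u)
      exact h1.comp_hasDerivAt u h2
    refine strictMonoOn_of_deriv_pos (convex_Ioo _ _)
      (fun u hu => (hd u hu).continuousAt.continuousWithinAt) fun u hu => ?_
    rw [interior_Ioo] at hu
    rw [(hd u hu).deriv]
    exact (hball _ (hmemp s hs y hy u hu)).2
  refine ⟨ψ, K, r, u₀ - ρ, u₀ + ρ, ⟨by linarith, by linarith⟩, ?_⟩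
  have hmem : ∀ s ∈ Metric.ball t r, ∀ y ∈ Metric.ball y₀ r,
      ψ (s, y) ∈ Ioo (u₀ - ρ) (u₀ + ρ) := fun s hs y hy => (hq _ (hmemq s hs y hy)).1.1
  have hzero : ∀ s ∈ Metric.ball t r, ∀ y ∈ Metric.ball y₀ r, Φ ((s, y), ψ (s, y)) = 0 :=
    fun s hs y hy => (hq _ (hmemq s hs y hy)).1.2
  refine ⟨hrpos, K.2, hmem, ?_, ?_, ?_, ?_, ?_⟩
  · intro s hs y hy
    have := hK.dist_le_mul _ (hq _ (hmemq s hs y hy)).2.2 _ (hq _ (hmemq t htr y hy)).2.2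
    simpa [Prod.dist_eq, Real.dist_eq] using this
  · intro s hs y hy u hu
    rw [← hzero s hs y hy]
    exact (hmono s hs y hy).lt_iff_lt (hmem s hs y hy) hu
  · intro s hs y hy u hu
    rw [← hzero s hs y hy]
    exact ⟨fun h => (hmono s hs y hy).injOn hu (hmem s hs y hy) h, fun h => by rw [h]⟩
  · intro y hy
    have h1 : ContinuousAt ψ (t, y) := (hq _ (hmemq t htr y hy)).2.1.continuousAt
    exact (ContinuousAt.comp (f := fun y => (t, y)) h1 (by fun_prop)).continuousWithinAt
  · intro y hy
    set c := fderiv ℝ Φ ((t, y), ψ (t, y)) (0, 1) with hc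
    have hg := hball _ (hmemp t htr y hy _ (hmem t htr y hy))
    have hΦd := (hg.1.differentiableAt one_ne_zero).hasFDerivAt
    have hψd : DifferentiableAt ℝ (fun s => ψ (s, y)) t := by
      have h1 := (hq _ (hmemq t htr y hy)).2.1.differentiableAt one_ne_zero
      exact DifferentiableAt.comp (f := fun s : ℝ => (s, y)) t h1 (by fun_prop)
    have hψd' := hψd.hasDerivAt
    set ψ' := deriv (fun s => ψ (s, y)) t
    have e1 : HasDerivAt (fun s => Φ ((s, y), ψ (t, y)))
        (fderiv ℝ Φ ((t, y), ψ (t, y)) ((1, 0), 0)) t := by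
      have h2 : HasDerivAt (fun s : ℝ => ((s, y), ψ (t, y))) (((1 : ℝ), (0 : F)), (0 : ℝ)) t :=
        ((hasDerivAt_id t).prodMk (hasDerivAt_const t y)).prodMk (hasDerivAt_const t _)
      exact hΦd.comp_hasDerivAt t h2
    have e2 : HasDerivAt (fun s => Φ ((s, y), ψ (s, y)))
        (fderiv ℝ Φ ((t, y), ψ (t, y)) ((1, 0), ψ')) t := by
      have h2 : HasDerivAt (fun s : ℝ => ((s, y), ψ (s, y))) (((1 : ℝ), (0 : F)), ψ') t :=
        ((hasDerivAt_id t).prodMk (hasDerivAt_const t y)).prodMk hψd'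
      exact hΦd.comp_hasDerivAt t h2
    have e3 : HasDerivAt (fun s => Φ ((s, y), ψ (s, y))) 0 t := by
      refine (hasDerivAt_const t (0 : ℝ)).congr_of_eventuallyEq ?_
      filter_upwards [Metric.ball_mem_nhds t hrpos] with s hs using hzero s hs y hy
    have e4 := e2.unique e3
    have e5 : (((1 : ℝ), (0 : F)), ψ') = ((1, 0), (0 : ℝ)) + ψ' • ((0 : ℝ × F), (1 : ℝ)) := by
      simp
    rw [e5, map_add, map_smul, smul_eq_mul, ← hc] at e4
    have hcpos : 0 < c := hg.2
    refine ⟨c⁻¹, inv_pos.2 hcpos, ?_⟩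
    have e6 : -(c⁻¹ * fderiv ℝ Φ ((t, y), ψ (t, y)) ((1, 0), 0)) = ψ' := by
      rw [inv_mul_eq_div, neg_eq_iff_eq_neg, div_eq_iff hcpos.ne']
      linarith
    rw [e1.deriv, e6]
    exact hψd'

namespace IsLocalGraph

variable {F : Type*} [NormedAddCommGroup F] {Φ : (ℝ × F) × ℝ → ℝ} {t : ℝ} {y₀ : F}
  {ψ : ℝ × F → ℝ} {K r a b : ℝ}

theorem center_mem (h : IsLocalGraph Φ t y₀ ψ K r a b) : t ∈ Metric.ball t r :=
  Metric.mem_ball_self h.r_pos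

variable [MeasureSpace F] [BorelSpace F]

/-- Vertical slices are intervals of length at most `2κ`. Width `κ = 0` makes the interface
negligible, and `κ = K |s - t|` gives the finite speed of the phase. -/
theorem volume_tube_le [SFinite (volume : Measure F)] (h : IsLocalGraph Φ t y₀ ψ K r a b) (κ : ℝ) :
    volume {p : F × ℝ | p.1 ∈ Metric.ball y₀ r ∧ |p.2 - ψ (t, p.1)| ≤ κ} ≤
      volume (Metric.ball y₀ r) * ENNReal.ofReal (2 * κ) := by
  classical
  set g : F → ℝ := (Metric.ball y₀ r).piecewise (fun y => ψ (t, y)) 0 with hg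
  have hgm : Measurable g :=
    h.cont.measurable_piecewise continuousOn_const Metric.isOpen_ball.measurableSet
  have heq : {p : F × ℝ | p.1 ∈ Metric.ball y₀ r ∧ |p.2 - ψ (t, p.1)| ≤ κ} =
      {p : F × ℝ | p.1 ∈ Metric.ball y₀ r} ∩ {p : F × ℝ | |p.2 - g p.1| ≤ κ} := by
    ext p
    refine and_congr_right fun hp => ?_
    simp only [mem_ofPred_eq]
    rw [hg, piecewise_eq_of_mem _ _ _ hp]
  have hm : MeasurableSet {p : F × ℝ | p.1 ∈ Metric.ball y₀ r ∧ |p.2 - ψ (t, p.1)| ≤ κ} := by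
    rw [heq]
    refine (measurable_fst Metric.isOpen_ball.measurableSet).inter ?_
    exact measurableSet_le (continuous_abs.measurable.comp
      (measurable_snd.sub (hgm.comp measurable_fst))) measurable_const
  rw [Measure.volume_eq_prod, Measure.prod_apply hm]
  have hle : ∀ y, volume (Prod.mk y ⁻¹' {p : F × ℝ | p.1 ∈ Metric.ball y₀ r ∧
      |p.2 - ψ (t, p.1)| ≤ κ}) ≤
      (Metric.ball y₀ r).indicator (fun _ => ENNReal.ofReal (2 * κ)) y := fun y => by
    by_cases hy : y ∈ Metric.ball y₀ r
    · rw [indicator_of_mem hy, ← Real.volume_closedBall (ψ (t, y))]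
      exact measure_mono fun u hu => by simpa [Real.dist_eq] using hu.2
    · rw [indicator_of_notMem hy]
      refine le_of_eq (measure_mono_null (fun u hu => (hy hu.1).elim) measure_empty)
  refine (lintegral_mono hle).trans ?_
  rw [lintegral_indicator Metric.isOpen_ball.measurableSet, setLIntegral_const, mul_comm]

theorem volume_zero_eq_zero [SFinite (volume : Measure F)]
    (h : IsLocalGraph Φ t y₀ ψ K r a b) :
    volume {p ∈ Metric.ball y₀ r ×ˢ Ioo a b | Φ ((t, p.1), p.2) = 0} = 0 := by
  have h1 := h.volume_tube_le 0
  rw [mul_zero, ENNReal.ofReal_zero, mul_zero, nonpos_iff_eq_zero] at h1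
  refine measure_mono_null ?_ h1
  intro p hp
  refine ⟨hp.1.1, ?_⟩
  simp [(h.zero_iff t h.center_mem p.1 hp.1.1 p.2 hp.1.2).1 hp.2]

/-- A point that changes phase lies between the graphs at times `s` and `t`, hence within `K |s -
t|` of the latter. -/
theorem volume_symmDiff_le [SFinite (volume : Measure F)] (h : IsLocalGraph Φ t y₀ ψ K r a b)
    {D : Set (F × ℝ)} {s : ℝ} (hs : s ∈ Metric.ball t r) :
    volume (({p ∈ D | 0 < Φ ((s, p.1), p.2)} ∆ {p ∈ D | 0 < Φ ((t, p.1), p.2)}) ∩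
      Metric.ball y₀ r ×ˢ Ioo a b) ≤
        volume (Metric.ball y₀ r) * ENNReal.ofReal (2 * (K * |s - t|)) := by
  refine le_trans (measure_mono ?_) (h.volume_tube_le (K * |s - t|))
  intro p hp
  refine ⟨hp.2.1, ?_⟩
  have h1 := h.pos_iff s hs p.1 hp.2.1 p.2 hp.2.2
  have h2 := h.pos_iff t h.center_mem p.1 hp.2.1 p.2 hp.2.2
  have h3 := h.lip s hs p.1 hp.2.1
  rw [abs_le] at h3 ⊢
  rcases hp.1 with ⟨⟨hD, h4⟩, h5⟩ | ⟨⟨hD, h4⟩, h5⟩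
  · have h6 : ¬ 0 < Φ ((t, p.1), p.2) := fun h6 => h5 ⟨hD, h6⟩
    rw [h2, not_lt] at h6
    have h7 := h1.1 h4
    constructor <;> linarith
  · have h6 : ¬ 0 < Φ ((s, p.1), p.2) := fun h6 => h5 ⟨hD, h6⟩
    rw [h1, not_lt] at h6
    have h7 := h2.1 h4
    constructor <;> linarith

/-- Derivative of the integral over the moving region, for an integrand supported in the box. -/
theorem exists_hasDerivAt_integral [SecondCountableTopology F] [SFinite (volume : Measure F)]
    [(volume : Measure F).IsOpenPosMeasure]
    (h : IsLocalGraph Φ t y₀ ψ K r a b) {D : Set (F × ℝ)} (hD : IsOpen D)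
    (hDfin : volume D < ⊤) (hball : volume (Metric.ball y₀ r) < ⊤)
    (hmeas : ∀ᶠ s in 𝓝 t, MeasurableSet {p ∈ D | 0 < Φ ((s, p.1), p.2)})
    (hbdry : ∀ᵐ y : F, y ∈ Metric.ball y₀ r → (y, ψ (t, y)) ∉ frontier D)
    {v w : F × ℝ → ℝ} (hv : ContinuousOn v D)
    (hvderiv : ∀ p ∈ D, v p = deriv (fun s => Φ ((s, p.1), p.2)) t)
    (hw : ContinuousOn w D) {M : ℝ} (hM : ∀ p ∈ D, |w p| ≤ M)
    (hsupp : ∀ p ∈ D, p ∉ Metric.ball y₀ r ×ˢ Ioo a b → w p = 0)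
    (hsign : ∀ p ∈ D, 0 ≤ w p * v p) :
    ∃ l ≥ 0, HasDerivAt (fun s => ∫ p in {p ∈ D | 0 < Φ ((s, p.1), p.2)}, w p) l t ∧
      ((∃ p ∈ D, Φ ((t, p.1), p.2) = 0 ∧ 0 < w p * v p) → 0 < l) := by
  classical
  set A : ℝ → Set (F × ℝ) := fun s => {p ∈ D | 0 < Φ ((s, p.1), p.2)} with hA
  set W : F × ℝ → ℝ := D.piecewise w 0 with hW
  have hWm : Measurable W := hw.measurable_piecewise continuousOn_const hD.measurableSet
  have hWD : ∀ p ∈ D, W p = w p := fun p hp => piecewise_eq_of_mem _ _ _ hp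
  have hWDc : ∀ p ∉ D, W p = 0 := fun p hp => piecewise_eq_of_notMem _ _ _ hp
  have hM' : ∀ p, |W p| ≤ |M| := fun p => by
    by_cases hp : p ∈ D
    · rw [hWD p hp]; exact (hM p hp).trans (le_abs_self M)
    · rw [hWDc p hp, abs_zero]; exact abs_nonneg _
  have hWQ : ∀ p, p ∉ Metric.ball y₀ r ×ˢ Ioo a b → W p = 0 := fun p hp => by
    by_cases hpD : p ∈ D
    · rw [hWD p hpD]; exact hsupp p hpD hp
    · exact hWDc p hpD
  have hWint : Integrable W := by
    have : IntegrableOn (fun _ : F × ℝ => |M|) D := integrableOn_const hDfin.ne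
    have h1 : IntegrableOn W D := Integrable.mono' this hWm.aestronglyMeasurable
      (ae_of_all _ hM')
    exact h1.integrable_of_forall_notMem_eq_zero hWDc
  have hslice : ∀ y u v', IntervalIntegrable (fun u => W (y, u)) volume u v' := fun y u v' => by
    refine (intervalIntegrable_const (c := |M|)).mono_fun
      (hWm.comp measurable_prodMk_left).aestronglyMeasurable (ae_of_all _ fun z => ?_)
    simpa using hM' (y, z)
  -- Fubini: the slice of the positive region is the part above the graph. Integrating up to `b` is
  -- harmless because `W` vanishes outside `D` and outside the box.
  let f : ℝ → F → ℝ := fun s y => ∫ u in ψ (s, y)..b, W (y, u)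
  have hinner : ∀ s ∈ Metric.ball t r, ∀ y,
      ∫ u, (A s).indicator W (y, u) = (Metric.ball y₀ r).indicator (f s) y := by
    intro s hs y
    by_cases hy : y ∈ Metric.ball y₀ r
    · rw [indicator_of_mem hy]
      have hψ := h.mem s hs y hy
      simp only [f]
      rw [intervalIntegral.integral_of_le hψ.2.le, ← integral_indicator measurableSet_Ioc]
      refine integral_congr_ae (ae_of_all _ fun u => ?_)
      beta_reduce
      by_cases hu : (y, u) ∈ D ∩ Metric.ball y₀ r ×ˢ Ioo a b
      · have h1 : (y, u) ∈ A s ↔ u ∈ Ioc (ψ (s, y)) b := by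
          have := h.pos_iff s hs y hy u hu.2.2
          exact ⟨fun h2 => ⟨this.1 h2.2, hu.2.2.2.le⟩, fun h2 => ⟨hu.1, this.2 h2.1⟩⟩
        by_cases h2 : u ∈ Ioc (ψ (s, y)) b
        · rw [indicator_of_mem (h1.2 h2), indicator_of_mem h2]
        · rw [indicator_of_notMem (mt h1.1 h2), indicator_of_notMem h2]
      · have h0 : W (y, u) = 0 := by
          by_cases h1 : (y, u) ∈ D
          · exact hWQ _ fun h2 => hu ⟨h1, h2⟩
          · exact hWDc _ h1
        simp only [indicator_apply, h0, ite_self]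
    · rw [indicator_of_notMem hy]
      refine integral_eq_zero_of_ae (ae_of_all _ fun u => ?_)
      have h0 : W (y, u) = 0 := hWQ _ fun h2 => hy h2.1
      simp [indicator_apply, h0]
  have hfub : ∀ᶠ s in 𝓝 t, IntegrableOn (f s) (Metric.ball y₀ r) ∧
      ∫ p in A s, w p = ∫ y in Metric.ball y₀ r, f s y := by
    filter_upwards [hmeas, Metric.ball_mem_nhds t h.r_pos] with s hsm hs
    have hi : Integrable ((A s).indicator W) := hWint.indicator hsm
    constructor
    · rw [← integrable_indicator_iff Metric.isOpen_ball.measurableSet]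
      exact hi.integral_prod_left.congr (ae_of_all _ fun y => hinner s hs y)
    · have e1 : ∫ p in A s, w p = ∫ p in A s, W p :=
        setIntegral_congr_fun hsm fun p hp => (hWD p hp.1).symm
      rw [e1, ← integral_indicator hsm, Measure.volume_eq_prod, integral_prod _ hi,
        ← integral_indicator Metric.isOpen_ball.measurableSet]
      exact integral_congr_ae (ae_of_all _ fun y => hinner s hs y)
  have hfsub : ∀ s ∈ Metric.ball t r, ∀ y ∈ Metric.ball y₀ r,
      |f s y - f t y| ≤ |M| * K * |s - t| := by
    intro s hs y hy
    have e1 : f s y - f t y = ∫ u in ψ (s, y)..ψ (t, y), W (y, u) := by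
      have := intervalIntegral.integral_add_adjacent_intervals (hslice y (ψ (s, y)) (ψ (t, y)))
        (hslice y (ψ (t, y)) b)
      simp only [f]
      linarith
    rw [e1, mul_assoc]
    refine (intervalIntegral.norm_integral_le_of_norm_le_const (f := fun u => W (y, u))
      (C := |M|) fun u _ => hM' (y, u)).trans ?_
    refine mul_le_mul_of_nonneg_left ?_ (abs_nonneg _)
    rw [abs_sub_comm]
    exact h.lip s hs y hy
  choose! c hcpos hc using h.velocity
  let f' : F → ℝ := fun y => W (y, ψ (t, y)) *
    (c y * deriv (fun s => Φ ((s, y), ψ (t, y))) t)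
  -- `W` can jump only across `frontier D`, which the graph avoids over almost every `y`; there the
  -- fundamental theorem of calculus applies at the moving endpoint.
  have hcontW : ∀ p, p ∉ frontier D → ContinuousAt W p := by
    intro p hp
    by_cases hpD : p ∈ D
    · refine (hw.continuousAt (hD.mem_nhds hpD)).congr ?_
      filter_upwards [hD.mem_nhds hpD] with q hq using (hWD q hq).symm
    · have hpc : p ∉ closure D := fun hcl => hp (by rw [hD.frontier_eq]; exact ⟨hcl, hpD⟩)
      refine (continuousAt_const (y := (0 : ℝ))).congr ?_
      filter_upwards [isClosed_closure.isOpen_compl.mem_nhds hpc] with q hq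
      exact (hWDc q fun hqD => hq (subset_closure hqD)).symm
  have hderiv : ∀ y ∈ Metric.ball y₀ r, (y, ψ (t, y)) ∉ frontier D →
      HasDerivAt (fun s => f s y) (f' y) t := by
    intro y hy hfr
    have h1 : HasDerivAt (fun z => ∫ u in z..b, W (y, u)) (-W (y, ψ (t, y))) (ψ (t, y)) := by
      refine intervalIntegral.integral_hasDerivAt_left (hslice _ _ _)
        ((hWm.comp measurable_prodMk_left).stronglyMeasurable.stronglyMeasurableAtFilter) ?_
      exact ContinuousAt.comp (f := fun u => (y, u)) (hcontW _ hfr) (by fun_prop)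
    have h2 := h1.comp t (hc y hy)
    rwa [neg_mul_neg] at h2
  have hae : ∀ᵐ y ∂(volume.restrict (Metric.ball y₀ r)),
      HasDerivAt (fun s => f s y) (f' y) t := by
    filter_upwards [ae_restrict_of_ae hbdry, ae_restrict_mem Metric.isOpen_ball.measurableSet]
      with y h1 h2 using hderiv y h2 (h1 h2)
  have hslope : ∀ᵐ y ∂(volume.restrict (Metric.ball y₀ r)),
      Tendsto (fun s => (s - t)⁻¹ * (f s y - f t y)) (𝓝[≠] t) (𝓝 (f' y)) := by
    filter_upwards [hae] with y hy
    exact (hasDerivAt_iff_tendsto_slope.1 hy).congr fun s => by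
      rw [slope_def_module, smul_eq_mul]
  have hbound : ∀ s ∈ Metric.ball t r, ∀ y ∈ Metric.ball y₀ r,
      ‖(s - t)⁻¹ * (f s y - f t y)‖ ≤ |M| * K := fun s hs y hy => by
    rw [Real.norm_eq_abs, abs_mul, abs_inv]
    rcases eq_or_ne s t with rfl | hst
    · simp; exact mul_nonneg (abs_nonneg _) h.K_nonneg
    · rw [inv_mul_le_iff₀ (abs_pos.2 (sub_ne_zero.2 hst)), mul_comm |s - t|]
      exact hfsub s hs y hy
  have hft := hfub.self_of_nhds
  have hmeas' : ∀ᶠ s in 𝓝[≠] t, AEStronglyMeasurable (fun y => (s - t)⁻¹ * (f s y - f t y))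
      (volume.restrict (Metric.ball y₀ r)) := by
    filter_upwards [nhdsWithin_le_nhds hfub] with s hs
    exact ((hs.1.sub hft.1).const_mul _).aestronglyMeasurable
  have hnear : ∀ᶠ s in 𝓝[≠] t, s ∈ Metric.ball t r :=
    nhdsWithin_le_nhds (Metric.ball_mem_nhds t h.r_pos)
  have hlim := tendsto_integral_filter_of_dominated_convergence (fun _ => |M| * K) hmeas'
    (by
      filter_upwards [hnear] with s hs
      filter_upwards [ae_restrict_mem Metric.isOpen_ball.measurableSet] with y hy
      exact hbound s hs y hy)
    (integrableOn_const hball.ne) hslope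
  have hf'nn : ∀ y ∈ Metric.ball y₀ r, 0 ≤ f' y := fun y hy => by
    by_cases hp : (y, ψ (t, y)) ∈ D
    · have h1 := hsign _ hp
      have h2 : f' y = c y * (w (y, ψ (t, y)) * v (y, ψ (t, y))) := by
        simp only [f']
        rw [hWD _ hp, hvderiv _ hp]
        ring
      rw [h2]
      exact mul_nonneg (hcpos y hy).le h1
    · simp [f', hWDc _ hp]
  have hf'nn' : 0 ≤ᵐ[volume.restrict (Metric.ball y₀ r)] f' :=
    (ae_restrict_mem Metric.isOpen_ball.measurableSet).mono hf'nn
  refine ⟨∫ y in Metric.ball y₀ r, f' y, integral_nonneg_of_ae hf'nn', ?_, ?_⟩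
  · rw [hasDerivAt_iff_tendsto_slope]
    refine hlim.congr' ?_
    filter_upwards [nhdsWithin_le_nhds hfub] with s hs
    rw [slope_def_module, smul_eq_mul, hs.2, hft.2, integral_const_mul, integral_sub hs.1 hft.1]
  · rintro ⟨⟨y₁, u₁⟩, hpD, hp0, hpos⟩
    have hQ : (y₁, u₁) ∈ Metric.ball y₀ r ×ˢ Ioo a b := by
      by_contra hQ
      rw [hsupp _ hpD hQ, zero_mul] at hpos
      exact lt_irrefl _ hpos
    obtain rfl : u₁ = ψ (t, y₁) := (h.zero_iff t h.center_mem y₁ hQ.1 u₁ hQ.2).1 hp0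
    -- The factor `c` was chosen pointwise, so `f'` is not visibly measurable; measurability and the
    -- bound both pass to the limit from the difference quotients.
    have hf'int : IntegrableOn f' (Metric.ball y₀ r) := by
      obtain ⟨s, hs⟩ := exists_seq_tendsto (𝓝[≠] t)
      have hm : AEStronglyMeasurable f' (volume.restrict (Metric.ball y₀ r)) := by
        obtain ⟨k, hk⟩ := eventually_atTop.1 (hs.eventually hmeas')
        refine aestronglyMeasurable_of_tendsto_ae (u := (atTop : Filter ℕ))
          (f := fun j y => (s (j + k) - t)⁻¹ * (f (s (j + k)) y - f t y))
          (fun j => hk _ (Nat.le_add_left k j)) ?_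
        filter_upwards [hslope] with y hy
        exact (hy.comp hs).comp (tendsto_add_atTop_nat k)
      refine Integrable.mono' (g := fun _ => |M| * K) (integrableOn_const hball.ne) hm ?_
      filter_upwards [hslope, ae_restrict_mem Metric.isOpen_ball.measurableSet] with y hy hyb
      refine le_of_tendsto hy.norm ?_
      filter_upwards [hnear] with s hs using hbound s hs y hyb
    have hcont : ContinuousAt (fun y => (y, ψ (t, y))) y₁ :=
      continuousAt_id.prodMk (h.cont.continuousAt (Metric.isOpen_ball.mem_nhds hQ.1))
    -- Only `w * v` needs to be continuous: the factor `c` is merely positive, which suffices for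
    -- `f'` to stay positive near `y₁`.
    have hev : ∀ᶠ y in 𝓝 y₁, 0 < f' y := by
      have h1 : ∀ᶠ y in 𝓝 y₁, (y, ψ (t, y)) ∈ D := hcont.eventually (hD.mem_nhds hpD)
      have h2 : ContinuousAt (fun p => w p * v p) (y₁, ψ (t, y₁)) :=
        (hw.continuousAt (hD.mem_nhds hpD)).mul (hv.continuousAt (hD.mem_nhds hpD))
      have h3 : ∀ᶠ y in 𝓝 y₁, 0 < w (y, ψ (t, y)) * v (y, ψ (t, y)) :=
        hcont.eventually (h2.eventually (lt_mem_nhds hpos))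
      filter_upwards [h1, h3, Metric.isOpen_ball.mem_nhds hQ.1] with y e1 e2 e3
      have e4 : f' y = c y * (w (y, ψ (t, y)) * v (y, ψ (t, y))) := by
        simp only [f']
        rw [hWD _ e1, hvderiv _ e1]
        ring
      rw [e4]
      exact mul_pos (hcpos y e3) e2
    rw [setIntegral_pos_iff_support_of_nonneg_ae hf'nn' hf'int]
    refine Measure.measure_pos_of_mem_nhds volume (x := y₁) (inter_mem ?_
      (Metric.isOpen_ball.mem_nhds hQ.1))
    filter_upwards [hev] with y hy using hy.ne'

end IsLocalGraph

/-! ### Transport of the positive phase -/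

/-- The part of `Ω` on which the level set function is positive. -/
def positivePhase {n : ℕ} (Ω : Set (EuclideanSpace ℝ (Fin n)))
    (φ : EuclideanSpace ℝ (Fin n) → ℝ) : Set (EuclideanSpace ℝ (Fin n)) :=
  {x ∈ Ω | 0 < φ x}

theorem positivePhase_subset {n : ℕ} {Ω : Set (EuclideanSpace ℝ (Fin n))}
    {φ : EuclideanSpace ℝ (Fin n) → ℝ} : positivePhase Ω φ ⊆ Ω := fun _ hx => hx.1

/-- If `g h ≠ 0`, the vector `g h • h` has value `(g h)² > 0`, and some linear automorphism carries
the image of the vertical unit vector to it. In such coordinates the interface is a graph with the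
positive phase above it. -/
theorem exists_coordinates {m : ℕ} {g : EuclideanSpace ℝ (Fin (m + 1)) →L[ℝ] ℝ} (hg : g ≠ 0) :
    ∃ e : ((Fin m → ℝ) × ℝ) ≃L[ℝ] EuclideanSpace ℝ (Fin (m + 1)), 0 < g (e (0, 1)) := by
  obtain ⟨h, hh⟩ : ∃ h, g h ≠ 0 := by
    by_contra! hcon
    exact hg (ContinuousLinearMap.ext hcon)
  have hpos : 0 < g (g h • h) := by
    rw [map_smul, smul_eq_mul]
    exact mul_self_pos.2 hh
  have hne : g h • h ≠ 0 := fun h0 => by simp [h0] at hpos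
  let e₀ : ((Fin m → ℝ) × ℝ) ≃L[ℝ] EuclideanSpace ℝ (Fin (m + 1)) :=
    ContinuousLinearEquiv.ofFinrankEq (by simp)
  have hne₀ : e₀ (0, 1) ≠ 0 := by simp
  obtain ⟨B, hB⟩ := SeparatingDual.exists_continuousLinearEquiv_apply_eq (R := ℝ) hne₀ hne
  exact ⟨e₀.trans B, by simpa [hB] using hpos⟩

/-- Uniqueness of Haar measure. The coordinates need not be isometric, and only positivity of the
factor matters later. -/
theorem exists_volume_scaling {m : ℕ}
    (e : ((Fin m → ℝ) × ℝ) ≃L[ℝ] EuclideanSpace ℝ (Fin (m + 1))) :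
    ∃ c : NNReal, 0 < c ∧ (∀ S : Set (EuclideanSpace ℝ (Fin (m + 1))),
      volume S = c * volume (e ⁻¹' S)) ∧
      ∀ (S : Set (EuclideanSpace ℝ (Fin (m + 1)))) (w : EuclideanSpace ℝ (Fin (m + 1)) → ℝ),
        ∫ x in S, w x = c * ∫ p in e ⁻¹' S, w (e p) := by
  have hHaar : (Measure.map e.symm
      (volume : Measure (EuclideanSpace ℝ (Fin (m + 1))))).IsAddHaarMeasure :=
    e.symm.isAddHaarMeasure_map _
  have hHaar' : (volume : Measure ((Fin m → ℝ) × ℝ)).IsAddHaarMeasure := by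
    rw [Measure.volume_eq_prod]; infer_instance
  set c := Measure.addHaarScalarFactor (Measure.map e.symm
    (volume : Measure (EuclideanSpace ℝ (Fin (m + 1))))) volume with hc
  have hmap : Measure.map e.symm (volume : Measure (EuclideanSpace ℝ (Fin (m + 1)))) =
      c • volume := Measure.isAddLeftInvariant_eq_smul _ _
  let e' := e.symm.toHomeomorph.toMeasurableEquiv
  have hpre : ∀ S : Set (EuclideanSpace ℝ (Fin (m + 1))), e.symm ⁻¹' (e ⁻¹' S) = S := fun S => by
    ext x; simp
  refine ⟨c, Measure.addHaarScalarFactor_pos_of_isAddHaarMeasure _ _, fun S => ?_,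
    fun S w => ?_⟩
  · have h1 : Measure.map e' (volume : Measure (EuclideanSpace ℝ (Fin (m + 1)))) (e ⁻¹' S) =
        volume (e' ⁻¹' (e ⁻¹' S)) := e'.map_apply _
    have h2 : Measure.map e' (volume : Measure (EuclideanSpace ℝ (Fin (m + 1)))) = c • volume :=
      hmap
    rw [h2] at h1
    rw [← hpre S]
    refine h1.symm.trans ?_
    rw [hpre]
    rfl
  · have hmp : MeasurePreserving e' (volume : Measure (EuclideanSpace ℝ (Fin (m + 1))))
        (c • volume) := ⟨e'.measurable, hmap⟩
    have h1 := hmp.setIntegral_preimage_emb e'.measurableEmbedding (fun p => w (e p)) (e ⁻¹' S)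
    have h2 : ∀ x, e (e' x) = x := fun x => e.apply_symm_apply x
    simp only [h2] at h1
    have h3 : e' ⁻¹' (e ⁻¹' S) = S := hpre S
    rw [h3] at h1
    rw [h1, Measure.restrict_smul, integral_smul_nnreal_measure]
    rfl

/-- A neighbourhood in which the interface is negligible, the phase changes at finite speed, and
integrals over the moving phase are differentiable in time. -/
structure IsTransportNhd {n : ℕ} (Ω : Set (EuclideanSpace ℝ (Fin n)))
    (φ : ℝ → EuclideanSpace ℝ (Fin n) → ℝ) (t : ℝ) (U : Set (EuclideanSpace ℝ (Fin n))) :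
    Prop where
  isOpen : IsOpen U
  null : volume ({x ∈ Ω | φ t x = 0} ∩ U) = 0
  lip : ∃ C : ℝ, ∀ᶠ s in 𝓝 t,
    volume.real ((positivePhase Ω (φ s) ∆ positivePhase Ω (φ t)) ∩ U) ≤ C * |s - t|
  transport : ∀ w : EuclideanSpace ℝ (Fin n) → ℝ, ContinuousOn w Ω →
    (∃ M : ℝ, ∀ x ∈ Ω, |w x| ≤ M) → (∀ x ∈ Ω, x ∉ U → w x = 0) →
    (∀ x ∈ Ω, 0 ≤ w x * deriv (fun s => φ s x) t) →
    ∃ l ≥ 0, HasDerivAt (fun s => ∫ x in positivePhase Ω (φ s), w x) l t ∧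
      ((∃ x ∈ Ω, φ t x = 0 ∧ 0 < w x * deriv (fun s => φ s x) t) → 0 < l)

section Transport

variable {n : ℕ} {Ω : Set (EuclideanSpace ℝ (Fin n))} {φ : ℝ → EuclideanSpace ℝ (Fin n) → ℝ}
  {t : ℝ}

/-- Being `C¹` at a point is an open condition in space-time, and compactness of `closure Ω` gives a
common time interval. -/
theorem eventually_isOpen_positivePhase (hΩ : IsOpen Ω) (hb : Bornology.IsBounded Ω)
    (hreg : ∀ x ∈ closure Ω, ContDiffAt ℝ 1
      (fun q : ℝ × EuclideanSpace ℝ (Fin n) => φ q.1 q.2) (t, x)) :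
    ∀ᶠ s in 𝓝 t, IsOpen (positivePhase Ω (φ s)) := by
  have h1 := hb.isCompact_closure.eventually_forall_of_forall_eventually (x₀ := t)
    (P := fun s x => ContDiffAt ℝ 1
      (fun q : ℝ × EuclideanSpace ℝ (Fin n) => φ q.1 q.2) (s, x))
    fun x hx => (hreg x hx).eventually (by simp)
  filter_upwards [h1] with s hs
  have hc : ContinuousOn (φ s) Ω := fun x hx => by
    have h2 := (hs x (subset_closure hx)).continuousAt
    exact (ContinuousAt.comp (f := fun y => (s, y)) h2 (by fun_prop)).continuousWithinAt
  exact hc.isOpen_inter_preimage hΩ isOpen_Ioi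

theorem hasDerivAt_time {x : EuclideanSpace ℝ (Fin n)}
    (h : DifferentiableAt ℝ (fun q : ℝ × EuclideanSpace ℝ (Fin n) => φ q.1 q.2) (t, x)) :
    HasDerivAt (fun s => φ s x)
      (fderiv ℝ (fun q : ℝ × EuclideanSpace ℝ (Fin n) => φ q.1 q.2) (t, x) (1, 0)) t := by
  have h2 : HasDerivAt (fun s : ℝ => (s, x)) ((1 : ℝ), (0 : EuclideanSpace ℝ (Fin n))) t :=
    (hasDerivAt_id t).prodMk (hasDerivAt_const t x)
  exact h.hasFDerivAt.comp_hasDerivAt t h2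

theorem continuousOn_deriv_time
    (hreg : ∀ x ∈ closure Ω, ContDiffAt ℝ 1
      (fun q : ℝ × EuclideanSpace ℝ (Fin n) => φ q.1 q.2) (t, x)) :
    ContinuousOn (fun x => deriv (fun s => φ s x) t) (closure Ω) := by
  have h1 : ContinuousOn (fun x => fderiv ℝ
      (fun q : ℝ × EuclideanSpace ℝ (Fin n) => φ q.1 q.2) (t, x) (1, 0)) (closure Ω) := by
    intro x hx
    have h2 := ((hreg x hx).continuousAt_fderiv one_ne_zero).clm_apply
      (continuousAt_const (y := ((1 : ℝ), (0 : EuclideanSpace ℝ (Fin n)))))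
    exact (ContinuousAt.comp (f := fun y => (t, y)) h2 (by fun_prop)).continuousWithinAt
  exact h1.congr fun x hx =>
    (hasDerivAt_time ((hreg x hx).differentiableAt one_ne_zero)).deriv

/-- By continuity the sign of `φ` is constant near `(t, x₀)`, so the phase is stationary in a
neighbourhood and every increment vanishes. -/
theorem exists_isTransportNhd_of_ne_zero (hΩ : IsOpen Ω) (hb : Bornology.IsBounded Ω)
    (hreg : ∀ x ∈ closure Ω, ContDiffAt ℝ 1
      (fun q : ℝ × EuclideanSpace ℝ (Fin n) => φ q.1 q.2) (t, x))
    {x₀ : EuclideanSpace ℝ (Fin n)} (hx₀ : x₀ ∈ closure Ω) (hne : φ t x₀ ≠ 0) :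
    ∃ U, x₀ ∈ U ∧ IsTransportNhd Ω φ t U := by
  have h1 : ∀ᶠ q : ℝ × EuclideanSpace ℝ (Fin n) in 𝓝 (t, x₀), 0 < φ q.1 q.2 * φ t x₀ :=
    ((hreg x₀ hx₀).continuousAt.mul continuousAt_const).eventually
      (lt_mem_nhds (mul_self_pos.2 hne))
  rw [nhds_prod_eq] at h1
  obtain ⟨p, hp, p', hp', hpp⟩ := eventually_prod_iff.1 h1
  obtain ⟨U, hUp, hU, hxU⟩ := eventually_nhds_iff.1 hp'
  have hsame : ∀ᶠ s in 𝓝 t, positivePhase Ω (φ s) ∩ U = positivePhase Ω (φ t) ∩ U := by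
    have hpt := hp.self_of_nhds
    filter_upwards [hp] with s hs
    ext x
    refine and_congr_left fun hx => and_congr_right fun _ => ?_
    have h2 : 0 < φ s x * φ t x₀ := hpp hs (hUp x hx)
    have h3 : 0 < φ t x * φ t x₀ := hpp hpt (hUp x hx)
    rcases hne.lt_or_gt with h4 | h4
    · have := neg_of_mul_pos_left h2 h4.le
      have := neg_of_mul_pos_left h3 h4.le
      constructor <;> intro <;> linarith
    · exact ⟨fun _ => pos_of_mul_pos_left h3 h4.le, fun _ => pos_of_mul_pos_left h2 h4.le⟩
  have hzero : ∀ x ∈ U, φ t x ≠ 0 := fun x hx h0 => by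
    have h3 : 0 < φ t x * φ t x₀ := hpp hp.self_of_nhds (hUp x hx)
    simp [h0] at h3
  refine ⟨U, hxU, hU, ?_, ⟨0, ?_⟩, ?_⟩
  · refine measure_mono_null ?_ measure_empty
    rintro x ⟨hx, hxU'⟩
    exact (hzero x hxU' hx.2).elim
  · filter_upwards [hsame] with s hs
    have : (positivePhase Ω (φ s) ∆ positivePhase Ω (φ t)) ∩ U = ∅ := by
      rw [inter_symmDiff_distrib_right, hs, symmDiff_self]
      rfl
    simp [this]
  · intro w _ _ hw _
    refine ⟨0, le_rfl, ?_, ?_⟩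
    · have hI : ∀ s, IsOpen (positivePhase Ω (φ s)) → ∫ x in positivePhase Ω (φ s), w x =
          ∫ x in positivePhase Ω (φ s) ∩ U, w x := fun s hs =>
        setIntegral_eq_of_subset_of_forall_sdiff_eq_zero hs.measurableSet inter_subset_left
          fun x hx => hw x hx.1.1 fun hxU' => hx.2 ⟨hx.1, hxU'⟩
      have hopen := eventually_isOpen_positivePhase hΩ hb hreg
      refine (hasDerivAt_const t (∫ x in positivePhase Ω (φ t), w x)).congr_of_eventuallyEq ?_
      filter_upwards [hsame, hopen] with s hs hso
      rw [hI s hso, hI t hopen.self_of_nhds, hs]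
    · rintro ⟨x, hx, hx0, hpos⟩
      have hxU' : x ∈ U := by
        by_contra hxU'
        simp [hw x hx hxU'] at hpos
      exact (hzero x hxU' hx0).elim

end Transport

theorem exists_isTransportNhd_of_zero {m : ℕ} {Ω : Set (EuclideanSpace ℝ (Fin (m + 1)))}
    {φ : ℝ → EuclideanSpace ℝ (Fin (m + 1)) → ℝ} {t : ℝ}
    (hΩ : IsOpen Ω) (hb : Bornology.IsBounded Ω)
    (hreg : ∀ x ∈ closure Ω, ContDiffAt ℝ 1
      (fun q : ℝ × EuclideanSpace ℝ (Fin (m + 1)) => φ q.1 q.2) (t, x))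
    (hnull : Measure.hausdorffMeasure (m : ℝ) {x ∈ frontier Ω | φ t x = 0} = 0)
    {x₀ : EuclideanSpace ℝ (Fin (m + 1))} (hx₀ : x₀ ∈ closure Ω) (hzero : φ t x₀ = 0)
    (hgrad : fderiv ℝ (φ t) x₀ ≠ 0) :
    ∃ U, x₀ ∈ U ∧ IsTransportNhd Ω φ t U := by
  obtain ⟨e, he⟩ := exists_coordinates hgrad
  obtain ⟨c, hc, hvol, hinteg⟩ := exists_volume_scaling e
  set y₀ := (e.symm x₀).1 with hy₀
  set u₀ := (e.symm x₀).2 with hu₀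
  have hex₀ : e (y₀, u₀) = x₀ := e.apply_symm_apply x₀
  set Φ : (ℝ × (Fin m → ℝ)) × ℝ → ℝ := fun q => φ q.1.1 (e (q.1.2, q.2)) with hΦ
  have hφ₀ := (hreg x₀ hx₀)
  have hΦC : ContDiffAt ℝ 1 Φ ((t, y₀), u₀) := by
    have h1 : ContDiffAt ℝ 1 (fun q : (ℝ × (Fin m → ℝ)) × ℝ => (q.1.1, e (q.1.2, q.2)))
        ((t, y₀), u₀) := by
      refine ContDiffAt.prodMk (by fun_prop) (e.contDiff.contDiffAt.comp _ (by fun_prop))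
    refine ContDiffAt.comp (g := fun q : ℝ × EuclideanSpace ℝ (Fin (m + 1)) => φ q.1 q.2)
      ((t, y₀), u₀) ?_ h1
    simpa only [hex₀] using hφ₀
  have hΦpos : 0 < fderiv ℝ Φ ((t, y₀), u₀) (0, 1) := by
    have h1 : HasDerivAt (fun u => Φ ((t, y₀), u)) (fderiv ℝ Φ ((t, y₀), u₀) (0, 1)) u₀ := by
      have h2 : HasDerivAt (fun u : ℝ => ((t, y₀), u)) ((0 : ℝ × (Fin m → ℝ)), (1 : ℝ)) u₀ :=
        (hasDerivAt_const u₀ (t, y₀)).prodMk (hasDerivAt_id u₀)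
      exact (hΦC.differentiableAt one_ne_zero).hasFDerivAt.comp_hasDerivAt u₀ h2
    have h3 : HasDerivAt (fun u => φ t (e (y₀, u))) (fderiv ℝ (φ t) x₀ (e (0, 1))) u₀ := by
      have h4 : HasDerivAt (fun u : ℝ => e (y₀, u)) (e (0, 1)) u₀ := by
        have h5 : HasDerivAt (fun u : ℝ => (y₀, u)) ((0 : Fin m → ℝ), (1 : ℝ)) u₀ :=
          (hasDerivAt_const u₀ y₀).prodMk (hasDerivAt_id u₀)
        exact e.hasFDerivAt.comp_hasDerivAt u₀ h5
      have h6 : DifferentiableAt ℝ (φ t) x₀ :=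
        DifferentiableAt.comp (f := fun x => (t, x)) x₀ (hφ₀.differentiableAt one_ne_zero)
          (by fun_prop)
      have h7 : HasFDerivAt (φ t) (fderiv ℝ (φ t) x₀) (e (y₀, u₀)) := by
        rw [hex₀]; exact h6.hasFDerivAt
      exact h7.comp_hasDerivAt u₀ h4
    rw [h1.unique h3]
    exact he
  obtain ⟨ψ, K, r, a, b, hu₀mem, hG⟩ := exists_isLocalGraph hΦC
    (by simp only [hΦ, hex₀, hzero]) hΦpos
  set Q : Set ((Fin m → ℝ) × ℝ) := Metric.ball y₀ r ×ˢ Ioo a b with hQ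
  set U : Set (EuclideanSpace ℝ (Fin (m + 1))) := e.symm ⁻¹' Q with hU
  have hpreU : e ⁻¹' U = Q := by ext p; simp [hU]
  have hballfin : volume (Metric.ball y₀ r) < ⊤ := measure_ball_lt_top
  refine ⟨U, ⟨Metric.mem_ball_self hG.r_pos, hu₀mem⟩,
    (Metric.isOpen_ball.prod isOpen_Ioo).preimage e.symm.continuous, ?_, ?_, ?_⟩
  · rw [hvol, preimage_inter, hpreU]
    refine mul_eq_zero_of_right _ (measure_mono_null ?_ hG.volume_zero_eq_zero)
    intro p hp
    exact ⟨hp.2, hp.1.2⟩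
  · refine ⟨c * (volume.real (Metric.ball y₀ r) * (2 * K)), ?_⟩
    filter_upwards [Metric.ball_mem_nhds t hG.r_pos] with s hs
    have h1 : volume ((positivePhase Ω (φ s) ∆ positivePhase Ω (φ t)) ∩ U) ≤
        c * (volume (Metric.ball y₀ r) * ENNReal.ofReal (2 * (K * |s - t|))) := by
      rw [hvol, preimage_inter, hpreU]
      exact mul_le_mul_right (hG.volume_symmDiff_le (D := e ⁻¹' Ω) hs) _
    have hK : 0 ≤ 2 * (K * |s - t|) := by
      have := hG.K_nonneg
      positivity
    have h2 := ENNReal.toReal_mono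
      (ENNReal.mul_ne_top ENNReal.coe_ne_top
        (ENNReal.mul_ne_top hballfin.ne ENNReal.ofReal_ne_top)) h1
    rw [ENNReal.toReal_mul, ENNReal.toReal_mul, ENNReal.toReal_ofReal hK,
      ENNReal.coe_toReal] at h2
    refine h2.trans (le_of_eq ?_)
    simp only [Measure.real]
    ring
  · intro w hw hM hsupp hsign
    obtain ⟨M, hM⟩ := hM
    have hopen : ∀ᶠ s in 𝓝 t, IsOpen (positivePhase Ω (φ s)) :=
      eventually_isOpen_positivePhase hΩ hb hreg
    have hDfin : volume (e ⁻¹' Ω) < ⊤ := by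
      have h1 := hb.measure_lt_top (μ := volume)
      rw [hvol] at h1
      by_contra h2
      rw [not_lt, top_le_iff] at h2
      rw [h2, ENNReal.mul_top (by exact_mod_cast hc.ne')] at h1
      exact lt_irrefl _ h1
    -- The zero set on `frontier Ω` is null for the `m`-dimensional Hausdorff measure. Projection to
    -- the base is Lipschitz, and on `Fin m → ℝ` that measure is Lebesgue measure, so almost no
    -- point of the base lies under it.
    have hbdry : ∀ᵐ y : Fin m → ℝ, y ∈ Metric.ball y₀ r →
        (y, ψ (t, y)) ∉ frontier (e ⁻¹' Ω) := by
      let π : EuclideanSpace ℝ (Fin (m + 1)) →L[ℝ] (Fin m → ℝ) :=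
        (ContinuousLinearMap.fst ℝ (Fin m → ℝ) ℝ).comp
          (e.symm : EuclideanSpace ℝ (Fin (m + 1)) →L[ℝ] (Fin m → ℝ) × ℝ)
      have h1 : volume (π '' {x ∈ frontier Ω | φ t x = 0}) = 0 := by
        have h2 := π.lipschitz.hausdorffMeasure_image_le (d := (m : ℝ)) (by positivity)
          {x ∈ frontier Ω | φ t x = 0}
        rw [hnull, mul_zero, nonpos_iff_eq_zero] at h2
        rw [← hausdorffMeasure_pi_real, Fintype.card_fin]
        exact h2
      have h3 : ∀ᵐ y : Fin m → ℝ, y ∉ π '' {x ∈ frontier Ω | φ t x = 0} :=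
        measure_eq_zero_iff_ae_notMem.1 h1
      filter_upwards [h3] with y hy hyb hfr
      have hfr' : e (y, ψ (t, y)) ∈ frontier Ω := by
        have h4 : e ⁻¹' frontier Ω = frontier (e ⁻¹' Ω) :=
          e.toHomeomorph.preimage_frontier Ω
        rw [← h4] at hfr
        exact hfr
      refine hy ⟨e (y, ψ (t, y)), ⟨hfr', ?_⟩, ?_⟩
      · exact (hG.zero_iff t hG.center_mem y hyb _ (hG.mem t hG.center_mem y hyb)).2 rfl
      · simp [π]
    have hv := (continuousOn_deriv_time hreg).mono (subset_closure (s := Ω))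
    obtain ⟨l, hl, hder, hlpos⟩ := hG.exists_hasDerivAt_integral
      (hΩ.preimage e.continuous) hDfin hballfin
      (hopen.mono fun s hs => (hs.preimage e.continuous).measurableSet) hbdry
      (v := fun p => deriv (fun s => φ s (e p)) t) (w := fun p => w (e p))
      (hv.comp e.continuous.continuousOn fun p hp => hp) (fun p _ => rfl)
      (hw.comp e.continuous.continuousOn fun p hp => hp) (M := M) (fun p hp => hM _ hp)
      (fun p hp hpQ => hsupp _ hp fun h => hpQ (by
        rwa [hU, mem_preimage, e.symm_apply_apply] at h))
      (fun p hp => hsign _ hp)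
    refine ⟨c * l, by positivity, ?_, ?_⟩
    · refine (hder.const_mul (c : ℝ)).congr_of_eventuallyEq (Eventually.of_forall fun s => ?_)
      exact hinteg _ w
    · rintro ⟨x, hx, hx0, hpos⟩
      have := hlpos ⟨e.symm x, by simpa using hx, by simpa [hΦ] using hx0, by simpa using hpos⟩
      have hc' : (0 : ℝ) < c := by exact_mod_cast hc
      positivity

/-- Motion of a regular phase: the interface is negligible, the phase changes at finite speed,
and the integral of the velocity over the phase is increasing unless the interface is
stationary. -/
theorem exists_hasDerivAt_integral_positivePhase {m : ℕ}
    {Ω : Set (EuclideanSpace ℝ (Fin (m + 1)))}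
    {φ : ℝ → EuclideanSpace ℝ (Fin (m + 1)) → ℝ} {t : ℝ}
    (hΩ : IsOpen Ω) (hb : Bornology.IsBounded Ω)
    (hreg : ∀ x ∈ closure Ω, ContDiffAt ℝ 1
      (fun q : ℝ × EuclideanSpace ℝ (Fin (m + 1)) => φ q.1 q.2) (t, x))
    (hnull : Measure.hausdorffMeasure (m : ℝ) {x ∈ frontier Ω | φ t x = 0} = 0)
    (hgrad : ∀ x ∈ closure Ω, φ t x = 0 → fderiv ℝ (φ t) x ≠ 0) :
    volume {x ∈ Ω | φ t x = 0} = 0 ∧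
    (∃ C : ℝ, ∀ᶠ s in 𝓝 t,
      volume.real (positivePhase Ω (φ s) ∆ positivePhase Ω (φ t)) ≤ C * |s - t|) ∧
    ∃ l ≥ 0, HasDerivAt
      (fun s => ∫ x in positivePhase Ω (φ s), deriv (fun s' => φ s' x) t) l t ∧
      ((∃ x ∈ Ω, φ t x = 0 ∧ deriv (fun s => φ s x) t ≠ 0) → 0 < l) := by
  have hloc : ∀ x ∈ closure Ω, ∃ U, x ∈ U ∧ IsTransportNhd Ω φ t U := fun x hx => by
    by_cases h0 : φ t x = 0
    · exact exists_isTransportNhd_of_zero hΩ hb hreg hnull hx h0 (hgrad x hx h0)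
    · exact exists_isTransportNhd_of_ne_zero hΩ hb hreg hx h0
  choose! U hxU hU using hloc
  have hK : IsCompact (closure Ω) := hb.isCompact_closure
  obtain ⟨F, hF, hcover⟩ := hK.elim_nhds_subcover U
    fun x hx => (hU x hx).isOpen.mem_nhds (hxU x hx)
  let σ := F.equivFin.symm
  let V : Fin F.card → Set (EuclideanSpace ℝ (Fin (m + 1))) := fun i => U (σ i)
  have hV : ∀ i, IsTransportNhd Ω φ t (V i) := fun i => hU _ (hF _ (σ i).2)
  have hcoverV : closure Ω ⊆ ⋃ i, V i := fun x hx => by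
    obtain ⟨y, hy, hxy⟩ := mem_iUnion₂.1 (hcover hx)
    exact mem_iUnion.2 ⟨σ.symm ⟨y, hy⟩, by simpa [V] using hxy⟩
  -- Localising the velocity as `ρ i * v` preserves the sign condition, because `(ρ i * v) * v = ρ i
  -- * v²` is nonnegative.
  obtain ⟨ρ, hρsupp, hρsum, hρ01, -⟩ :=
    exists_continuous_sum_one_of_isOpen_isCompact (fun i => (hV i).isOpen) hK hcoverV
  have hsum : ∀ x ∈ closure Ω, ∑ i, ρ i x = 1 := fun x hx => by
    simpa using hρsum hx
  set v : EuclideanSpace ℝ (Fin (m + 1)) → ℝ := fun x => deriv (fun s => φ s x) t with hvdef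
  have hvc : ContinuousOn v (closure Ω) := continuousOn_deriv_time hreg
  obtain ⟨M, hM⟩ := hK.exists_bound_of_continuousOn hvc
  have hfin : volume Ω < ⊤ := hb.measure_lt_top
  have hwc : ∀ i, ContinuousOn (fun x => ρ i x * v x) Ω := fun i =>
    (ρ i).continuous.continuousOn.mul (hvc.mono subset_closure)
  have hwM : ∀ i, ∀ x ∈ Ω, |ρ i x * v x| ≤ M := fun i x hx => by
    rw [abs_mul, abs_of_nonneg (hρ01 i x).1]
    have h1 := hM x (subset_closure hx)
    rw [Real.norm_eq_abs] at h1
    exact (mul_le_of_le_one_left (abs_nonneg _) (hρ01 i x).2).trans h1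
  have htrans := fun i => (hV i).transport (fun x => ρ i x * v x) (hwc i) ⟨M, hwM i⟩
    (fun x _ hxV => by
      have h0 : ρ i x = 0 := by
        by_contra hne
        exact hxV (hρsupp i (subset_tsupport _ hne))
      rw [h0, zero_mul])
    (fun x _ => by
      rw [mul_assoc]
      exact mul_nonneg (hρ01 i x).1 (mul_self_nonneg _))
  choose l hl hder hlpos using htrans
  refine ⟨?_, ?_, ∑ i, l i, Finset.sum_nonneg fun i _ => hl i, ?_, ?_⟩
  · refine measure_mono_null ?_ (measure_iUnion_null fun i => (hV i).null)
    intro x hx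
    obtain ⟨i, hi⟩ := mem_iUnion.1 (hcoverV (subset_closure hx.1))
    exact mem_iUnion.2 ⟨i, hx, hi⟩
  · choose C hC using fun i => (hV i).lip
    refine ⟨∑ i, C i, ?_⟩
    filter_upwards [eventually_all.2 hC] with s hs
    rw [Finset.sum_mul]
    refine le_trans ?_ (Finset.sum_le_sum fun i _ => hs i)
    have hsub : positivePhase Ω (φ s) ∆ positivePhase Ω (φ t) ⊆
        ⋃ i, (positivePhase Ω (φ s) ∆ positivePhase Ω (φ t)) ∩ V i := fun x hx => by
      have hxΩ : x ∈ Ω := by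
        rcases hx with h | h
        exacts [h.1.1, h.1.1]
      obtain ⟨i, hi⟩ := mem_iUnion.1 (hcoverV (subset_closure hxΩ))
      exact mem_iUnion.2 ⟨i, hx, hi⟩
    have hfin' : volume (⋃ i, (positivePhase Ω (φ s) ∆ positivePhase Ω (φ t)) ∩ V i) ≠ ⊤ := by
      refine ne_top_of_le_ne_top hfin.ne (measure_mono (iUnion_subset fun i x hx => ?_))
      rcases hx.1 with h | h
      exacts [h.1.1, h.1.1]
    exact (measureReal_mono hsub hfin').trans (measureReal_iUnion_fintype_le _)
  · refine (HasDerivAt.fun_sum fun i _ => hder i).congr_of_eventuallyEq ?_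
    filter_upwards [eventually_isOpen_positivePhase hΩ hb hreg] with s hs
    have hi : ∀ i, IntegrableOn (fun x => ρ i x * v x) (positivePhase Ω (φ s)) := fun i => by
      have h1 : IntegrableOn (fun _ : EuclideanSpace ℝ (Fin (m + 1)) => M) Ω :=
        integrableOn_const hfin.ne
      have h2 : IntegrableOn (fun x => ρ i x * v x) Ω := Integrable.mono' h1
        ((hwc i).aestronglyMeasurable hΩ.measurableSet)
        ((ae_restrict_mem hΩ.measurableSet).mono fun x hx => hwM i x hx)
      exact h2.mono_set positivePhase_subset
    rw [← integral_finsetSum _ fun i _ => hi i]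
    refine setIntegral_congr_fun hs.measurableSet fun x hx => ?_
    rw [← Finset.sum_mul, hsum x (subset_closure hx.1), one_mul]
  · rintro ⟨x, hx, hx0, hne⟩
    -- The weights sum to one at the moving point `x`, so one is positive there and makes its local
    -- derivative `l i` positive; the others are nonnegative.
    obtain ⟨i, -, hi⟩ : ∃ i ∈ Finset.univ, 0 < ρ i x := by
      refine Finset.exists_lt_of_sum_lt (f := fun _ => (0 : ℝ)) ?_
      rw [hsum x (subset_closure hx)]
      simp
    refine Finset.sum_pos' (fun i _ => hl i) ⟨i, Finset.mem_univ _, hlpos i ⟨x, hx, hx0, ?_⟩⟩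
    rw [mul_assoc]
    exact mul_pos hi (mul_self_pos.2 hne)

/-! ### The topological derivative as a density -/

theorem ball_ae_eq_closedBall {m : ℕ} (y : EuclideanSpace ℝ (Fin (m + 1))) (ε : ℝ) :
    (Metric.ball y ε : Set _) =ᵐ[volume] Metric.closedBall y ε := by
  refine ae_eq_of_subset_of_measure_ge Metric.ball_subset_closedBall ?_
    Metric.isOpen_ball.measurableSet.nullMeasurableSet measure_closedBall_lt_top.ne
  rw [Measure.addHaar_closedBall_eq_addHaar_ball]

theorem tendsto_volume_ball {m : ℕ} (y : EuclideanSpace ℝ (Fin (m + 1))) :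
    Tendsto (fun ε : ℝ => volume.real (Metric.ball y ε)) (𝓝[>] 0) (𝓝 0) := by
  have h1 : Tendsto (fun ε : ℝ => ε ^ (m + 1) *
      volume.real (Metric.ball (0 : EuclideanSpace ℝ (Fin (m + 1))) 1)) (𝓝[>] 0) (𝓝 0) := by
    have h2 : Continuous fun ε : ℝ => ε ^ (m + 1) *
      volume.real (Metric.ball (0 : EuclideanSpace ℝ (Fin (m + 1))) 1) := by fun_prop
    have h3 := h2.tendsto 0
    simp only [ne_eq, Nat.add_eq_zero_iff, one_ne_zero, and_false, not_false_eq_true, zero_pow,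
      zero_mul] at h3
    exact h3.mono_left nhdsWithin_le_nhds
  refine h1.congr' ?_
  filter_upwards [self_mem_nhdsWithin] with ε hε
  rw [measureReal_def, measureReal_def, Measure.addHaar_ball _ _ (le_of_lt hε), ENNReal.toReal_mul,
    ENNReal.toReal_ofReal (pow_nonneg (le_of_lt hε) _), finrank_euclideanSpace_fin]

/-- Lebesgue differentiation along closed balls, transferred to the open balls of `HasRTD` since
spheres are null. -/
theorem ae_tendsto_average_ball {m : ℕ} {f : EuclideanSpace ℝ (Fin (m + 1)) → ℝ}
    (hf : Integrable f) :
    ∀ᵐ y, Tendsto (fun ε : ℝ => (∫ x in Metric.ball y ε, f x) / volume.real (Metric.ball y ε))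
      (𝓝[>] 0) (𝓝 (f y)) := by
  filter_upwards [IsUnifLocDoublingMeasure.ae_tendsto_average volume hf.locallyIntegrable 1]
    with y hy
  have h1 := hy (fun _ : ℝ => y) (fun ε => ε) (l := 𝓝[>] 0) tendsto_id (by
    filter_upwards [self_mem_nhdsWithin] with ε hε
    simpa using le_of_lt hε)
  refine h1.congr fun ε => ?_
  rw [← setAverage_congr (ball_ae_eq_closedBall y ε), setAverage_eq, smul_eq_mul,
    div_eq_inv_mul]

namespace DesignProblem

variable {n N p : ℕ}

theorem topology_eqOn_twoPhase (P : DesignProblem n N p) (φ : EuclideanSpace ℝ (Fin n) → ℝ) :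
    EqOn (P.topology φ) (twoPhase P.β (positivePhase P.Ω φ)) P.Ω := fun x hx => by
  by_cases h : 0 < φ x
  · have h' : x ∈ positivePhase P.Ω φ := ⟨hx, h⟩
    simp [topology, relaxedHeaviside, twoPhase, h, h']
  · have h' : x ∉ positivePhase P.Ω φ := fun h' => h h'.2
    simp [topology, relaxedHeaviside, twoPhase, h, h']

theorem exchangeOnBall_eqOn_diff {P : DesignProblem n N p}
    {φ : EuclideanSpace ℝ (Fin n) → ℝ} {y : EuclideanSpace ℝ (Fin n)} {ε : ℝ}
    (h : Metric.ball y ε ⊆ positivePhase P.Ω φ) :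
    EqOn (exchangeOnBall P.β (P.topology φ) y ε)
      (twoPhase P.β (positivePhase P.Ω φ \ Metric.ball y ε)) P.Ω := fun x hx => by
  have h1 := P.topology_eqOn_twoPhase φ hx
  by_cases hb : x ∈ Metric.ball y ε
  · have h2 : P.topology φ x = 1 := by rw [h1]; simp [twoPhase, h hb]
    have h3 : x ∉ positivePhase P.Ω φ \ Metric.ball y ε := fun h3 => h3.2 hb
    simp only [exchangeOnBall, Pi.add_apply, indicator_of_mem hb, phaseExchange, h2, twoPhase, h3,
      if_true, if_false]
    ring
  · have h2 : x ∈ positivePhase P.Ω φ \ Metric.ball y ε ↔ x ∈ positivePhase P.Ω φ :=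
      ⟨fun h => h.1, fun h => ⟨h, hb⟩⟩
    rw [exchangeOnBall, Pi.add_apply, indicator_of_notMem hb, h1, add_zero]
    by_cases h3 : x ∈ positivePhase P.Ω φ
    · rw [twoPhase, twoPhase, if_pos h3, if_pos (h2.2 h3)]
    · rw [twoPhase, twoPhase, if_neg h3, if_neg (mt h2.1 h3)]

theorem exchangeOnBall_eqOn_union {P : DesignProblem n N p} (hP : P.IsAdmissible)
    {φ : EuclideanSpace ℝ (Fin n) → ℝ} {y : EuclideanSpace ℝ (Fin n)} {ε : ℝ}
    (h : Disjoint (Metric.ball y ε) (positivePhase P.Ω φ)) :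
    EqOn (exchangeOnBall P.β (P.topology φ) y ε)
      (twoPhase P.β (positivePhase P.Ω φ ∪ Metric.ball y ε ∩ P.Ω)) P.Ω := fun x hx => by
  have h1 := P.topology_eqOn_twoPhase φ hx
  by_cases hb : x ∈ Metric.ball y ε
  · have h2 : P.topology φ x = P.β := by
      rw [h1]; simp [twoPhase, disjoint_left.1 h hb]
    have h3 : x ∈ positivePhase P.Ω φ ∪ Metric.ball y ε ∩ P.Ω := Or.inr ⟨hb, hx⟩
    simp only [exchangeOnBall, Pi.add_apply, indicator_of_mem hb, phaseExchange, h2, twoPhase, h3,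
      if_true, hP.β_lt_one.ne, if_false]
    ring
  · have h2 : x ∈ positivePhase P.Ω φ ∪ Metric.ball y ε ∩ P.Ω ↔ x ∈ positivePhase P.Ω φ :=
      ⟨fun h => h.resolve_right fun h => hb h.1, Or.inl⟩
    rw [exchangeOnBall, Pi.add_apply, indicator_of_notMem hb, h1, add_zero]
    by_cases h3 : x ∈ positivePhase P.Ω φ
    · rw [twoPhase, twoPhase, if_pos h3, if_pos (h2.2 h3)]
    · rw [twoPhase, twoPhase, if_neg h3, if_neg (mt h2.1 h3)]

/-- The relaxed topological derivative, normalised by `Δχ`, is a.e. the density of the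
Lagrangian with respect to the hard phase divided by `1 - β`. -/
theorem ae_rtd_eq_density {m : ℕ} {P : DesignProblem (m + 1) N p} (hP : P.IsAdmissible)
    (lam : ℝ) {φ : EuclideanSpace ℝ (Fin (m + 1)) → ℝ} (hφ : ContinuousOn φ P.Ω)
    {g : EuclideanSpace ℝ (Fin (m + 1)) → ℝ} (hg : IntegrableOn g P.Ω)
    (hgL : ∀ {ι : Type} {l : Filter ι} [l.IsCountablyGenerated]
        (A : ι → Set (EuclideanSpace ℝ (Fin (m + 1)))), (∀ i, MeasurableSet (A i)) →
        (∀ i, A i ⊆ P.Ω) →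
        Tendsto (fun i => volume.real (A i ∆ positivePhase P.Ω φ)) l (𝓝 0) →
        (fun i => P.lagrangian lam (twoPhase P.β (A i)) -
          P.lagrangian lam (twoPhase P.β (positivePhase P.Ω φ)) -
          ((∫ x in A i, g x) - ∫ x in positivePhase P.Ω φ, g x)) =o[l]
          fun i => volume.real (A i ∆ positivePhase P.Ω φ)) :
    ∀ᵐ y, y ∈ P.Ω → φ y ≠ 0 → ∀ r, HasRTD P.β (P.lagrangian lam) (P.topology φ) y r →
      1 / phaseExchange P.β (P.topology φ) y * r = g y / (1 - P.β) := by
  have hΩ := hP.isOpen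
  set A₀ := positivePhase P.Ω φ with hA₀
  have hA₀o : IsOpen A₀ := hφ.isOpen_inter_preimage hΩ isOpen_Ioi
  have hgi : Integrable (P.Ω.indicator g) := hg.integrable_indicator hΩ.measurableSet
  filter_upwards [ae_tendsto_average_ball hgi] with y hy hyΩ hy0 r hr
  rw [indicator_of_mem hyΩ] at hy
  have hsub : ∀ V ∈ 𝓝 y, ∀ᶠ ε : ℝ in 𝓝[>] 0, Metric.ball y ε ⊆ V := fun V hV => by
    obtain ⟨δ, hδ, hball⟩ := Metric.mem_nhds_iff.1 hV
    filter_upwards [nhdsWithin_le_nhds (gt_mem_nhds hδ)] with ε hε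
    exact (Metric.ball_subset_ball hε.le).trans hball
  have hΩball := hsub _ (hΩ.mem_nhds hyΩ)
  -- Common to both phases: `A ε` is the hard phase after the exchange, and `σ` is `1` if the ball
  -- is added and `-1` if it is removed. The same sign occurs in `Δχ = σ (1 - β)`, so the quotient
  -- does not depend on the phase.
  have key : ∀ (A : ℝ → Set (EuclideanSpace ℝ (Fin (m + 1)))) (σ : ℝ),
      (∀ ε, MeasurableSet (A ε)) → (∀ ε, A ε ⊆ P.Ω) →
      (∀ᶠ ε in 𝓝[>] 0, A ε ∆ A₀ = Metric.ball y ε ∧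
        EqOn (exchangeOnBall P.β (P.topology φ) y ε) (twoPhase P.β (A ε)) P.Ω ∧
        (∫ x in A ε, g x) - (∫ x in A₀, g x) = σ * ∫ x in Metric.ball y ε, g x) →
      r = σ * g y := by
    intro A σ hAm hAΩ hev
    have hvol : ∀ᶠ ε in 𝓝[>] (0 : ℝ),
        volume.real (Metric.ball y ε) = volume.real (A ε ∆ A₀) := by
      filter_upwards [hev] with ε hε
      rw [hε.1]
    have h1 := (hgL (l := 𝓝[>] (0 : ℝ)) A hAm hAΩ
      ((tendsto_volume_ball y).congr' hvol)).tendsto_div_nhds_zero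
    have h2 := h1.add (hy.const_mul σ)
    rw [zero_add] at h2
    refine tendsto_nhds_unique hr (h2.congr' ?_)
    filter_upwards [hev, hvol, hΩball, self_mem_nhdsWithin] with ε hε hεv hεΩ hε0
    rw [lagrangian_congr hP lam hε.2.1, lagrangian_congr hP lam (P.topology_eqOn_twoPhase φ),
      ← hεv, hε.2.2]
    have h3 : ∫ x in Metric.ball y ε, P.Ω.indicator g x = ∫ x in Metric.ball y ε, g x :=
      setIntegral_congr_fun Metric.isOpen_ball.measurableSet fun x hx =>
        indicator_of_mem (hεΩ hx) g
    rw [h3]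
    ring
  have hβ : 0 < 1 - P.β := sub_pos.2 hP.β_lt_one
  have hgball : ∀ {ε : ℝ}, Metric.ball y ε ⊆ P.Ω → IntegrableOn g (Metric.ball y ε) :=
    fun h => hg.mono_set h
  have hgA₀ : IntegrableOn g A₀ := hg.mono_set positivePhase_subset
  rcases hy0.lt_or_gt with hneg | hpos
  -- Soft point: the ball joins the hard phase. It is cut by `Ω` only because the sets must lie in
  -- `Ω` for every `ε`; for small `ε` the cut is void.
  · have hr' := key (fun ε => A₀ ∪ Metric.ball y ε ∩ P.Ω) 1
      (fun ε => hA₀o.measurableSet.union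
        (Metric.isOpen_ball.measurableSet.inter hΩ.measurableSet))
      (fun ε => union_subset positivePhase_subset inter_subset_right) (by
        have hV : P.Ω ∩ φ ⁻¹' Iio 0 ∈ 𝓝 y :=
          (hφ.isOpen_inter_preimage hΩ isOpen_Iio).mem_nhds ⟨hyΩ, hneg⟩
        filter_upwards [hsub _ hV] with ε hε
        have hdisj : Disjoint (Metric.ball y ε) A₀ := disjoint_left.2 fun x hx hxA =>
          lt_asymm hxA.2 (hε hx).2
        have hεΩ : Metric.ball y ε ⊆ P.Ω := fun x hx => (hε hx).1
        refine ⟨?_, exchangeOnBall_eqOn_union hP hdisj, ?_⟩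
        · rw [inter_eq_self_of_subset_left hεΩ]
          ext x
          have := fun h : x ∈ Metric.ball y ε => disjoint_left.1 hdisj h
          simp only [mem_symmDiff, mem_union]
          tauto
        · rw [inter_eq_self_of_subset_left hεΩ, setIntegral_union hdisj.symm
            Metric.isOpen_ball.measurableSet hgA₀ (hgball hεΩ)]
          ring)
    have hχ : P.topology φ y = P.β := by
      simp [topology, relaxedHeaviside, not_lt.2 hneg.le]
    simp only [phaseExchange, hχ, hP.β_lt_one.ne, if_false]
    rw [hr']
    ring
  · have hr' := key (fun ε => A₀ \ Metric.ball y ε) (-1)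
      (fun ε => hA₀o.measurableSet.diff Metric.isOpen_ball.measurableSet)
      (fun ε => sdiff_subset.trans positivePhase_subset) (by
        filter_upwards [hsub _ (hA₀o.mem_nhds ⟨hyΩ, hpos⟩)] with ε hε
        refine ⟨?_, exchangeOnBall_eqOn_diff hε, ?_⟩
        · ext x
          have := fun h : x ∈ Metric.ball y ε => hε h
          simp only [mem_symmDiff, Set.mem_sdiff]
          tauto
        · rw [setIntegral_sdiff Metric.isOpen_ball.measurableSet hgA₀ hε]
          ring)
    have hχ : P.topology φ y = 1 := by
      simp [topology, relaxedHeaviside, hpos]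
    simp only [phaseExchange, hχ, if_true]
    rw [hr']
    field_simp

/-! ### Descent along the evolution -/

theorem exists_hasDerivAt_lagrangian {m : ℕ} {P : DesignProblem (m + 1) N p}
    (hP : P.IsAdmissible) {k lam T : ℝ} (hk : 0 < k)
    {φ : ℝ → EuclideanSpace ℝ (Fin (m + 1)) → ℝ} (hφ : P.IsLevelSetEvolution k lam T φ)
    {t : ℝ} (ht : t ∈ Icc 0 T) (hR : P.RegularMovingInterface φ t) :
    ∃ L' : ℝ, HasDerivAt (fun s => P.lagrangian lam (P.topology (φ s))) L' t ∧ L' < 0 := by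
  classical
  obtain ⟨O, hO, hsubO, hC⟩ := hφ.regular
  have hreg : ∀ x ∈ closure P.Ω, ContDiffAt ℝ 1
      (fun q : ℝ × EuclideanSpace ℝ (Fin (m + 1)) => φ q.1 q.2) (t, x) := fun x hx =>
    hC.contDiffAt (hO.mem_nhds (hsubO ⟨ht, hx⟩))
  have hnull : Measure.hausdorffMeasure (m : ℝ) {x ∈ frontier P.Ω | φ t x = 0} = 0 := by
    have := hR.boundary_null
    rwa [Nat.cast_add, Nat.cast_one, add_sub_cancel_right] at this
  have hgrad : ∀ x ∈ closure P.Ω, φ t x = 0 → fderiv ℝ (φ t) x ≠ 0 := fun x hx h0 hf => by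
    refine hR.gradient_ne_zero x hx h0 ?_
    rw [gradient, hf, map_zero]
  obtain ⟨hZ, ⟨C, hlip⟩, l, -, hder, hlpos⟩ :=
    exists_hasDerivAt_integral_positivePhase hP.isOpen hP.isBounded hreg hnull hgrad
  have hl : 0 < l := by
    obtain ⟨x, hx, hne⟩ := hR.moving
    exact hlpos ⟨x, hx.1, hx.2, hne⟩
  have hopen := eventually_isOpen_positivePhase hP.isOpen hP.isBounded hreg
  have hA₀ := hopen.self_of_nhds
  have hcont : ContinuousOn (φ t) P.Ω := fun x hx =>
    (ContinuousAt.comp (f := fun y => (t, y)) (hreg x (subset_closure hx)).continuousAt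
      (by fun_prop)).continuousWithinAt
  obtain ⟨g, hg, hgL⟩ :=
    hP.exists_lagrangian_density lam hA₀.measurableSet positivePhase_subset
  have hβ : 0 < 1 - P.β := sub_pos.2 hP.β_lt_one
  -- The evolution equation holds off the interface, which is null, and so determines `g` almost
  -- everywhere. This suffices for the integrals over the phases.
  have hgv : ∀ᵐ y, y ∈ P.Ω → g y = -((1 - P.β) / k) * deriv (fun s => φ s y) t := by
    filter_upwards [ae_rtd_eq_density hP lam hcont hg hgL, measure_eq_zero_iff_ae_notMem.1 hZ]
      with y hy hyZ hyΩ
    have hy0 : φ t y ≠ 0 := fun h0 => hyZ ⟨hyΩ, h0⟩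
    obtain ⟨r, hr, hd⟩ := hφ.evolution t ht y hyΩ hy0
    rw [hd.deriv, mul_assoc (-k), hy hyΩ hy0 r hr]
    field_simp
  have hinteg : ∀ s, IsOpen (positivePhase P.Ω (φ s)) → ∫ x in positivePhase P.Ω (φ s), g x =
      -((1 - P.β) / k) * ∫ x in positivePhase P.Ω (φ s), deriv (fun s' => φ s' x) t :=
    fun s hs => by
      rw [← integral_const_mul]
      refine setIntegral_congr_ae hs.measurableSet ?_
      filter_upwards [hgv] with x hx hxA using hx hxA.1
  refine ⟨-((1 - P.β) / k) * l, ?_, by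
    rw [neg_mul]
    exact neg_lt_zero.2 (mul_pos (div_pos hβ hk) hl)⟩
  have hdg : HasDerivAt (fun s => ∫ x in positivePhase P.Ω (φ s), g x)
      (-((1 - P.β) / k) * l) t := by
    refine (hder.const_mul _).congr_of_eventuallyEq ?_
    filter_upwards [hopen] with s hs using hinteg s hs
  -- The expansion asks for measurable sets at all times, whereas `φ s` is controlled only for `s`
  -- near `t`; the default `∅` elsewhere does not affect the germ at `t`.
  let A : ℝ → Set (EuclideanSpace ℝ (Fin (m + 1))) := fun s =>
    if IsOpen (positivePhase P.Ω (φ s)) then positivePhase P.Ω (φ s) else ∅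
  have hAeq : ∀ s, IsOpen (positivePhase P.Ω (φ s)) → A s = positivePhase P.Ω (φ s) :=
    fun s hs => if_pos hs
  have hAm : ∀ s, MeasurableSet (A s) := fun s => by
    by_cases hs : IsOpen (positivePhase P.Ω (φ s))
    · rw [hAeq s hs]; exact hs.measurableSet
    · simp only [A, if_neg hs]; exact MeasurableSet.empty
  have hAΩ : ∀ s, A s ⊆ P.Ω := fun s => by
    by_cases hs : IsOpen (positivePhase P.Ω (φ s))
    · rw [hAeq s hs]; exact positivePhase_subset
    · simp only [A, if_neg hs]; exact empty_subset _
  have hO : (fun s => volume.real (A s ∆ positivePhase P.Ω (φ t))) =O[𝓝 t] fun s => s - t := by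
    refine IsBigO.of_bound C ?_
    filter_upwards [hopen, hlip] with s hs hsl
    rw [hAeq s hs, Real.norm_eq_abs, abs_of_nonneg measureReal_nonneg]
    exact hsl
  have hlim : Tendsto (fun s => volume.real (A s ∆ positivePhase P.Ω (φ t))) (𝓝 t) (𝓝 0) := by
    refine hO.trans_tendsto ?_
    have : Continuous fun s : ℝ => s - t := by fun_prop
    simpa using this.tendsto t
  have hexp := (hgL A hAm hAΩ hlim).trans_isBigO hO
  rw [hasDerivAt_iff_isLittleO] at hdg ⊢
  refine (hexp.add hdg).congr' ?_ EventuallyEq.rfl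
  filter_upwards [hopen] with s hs
  rw [hAeq s hs, lagrangian_congr hP lam (P.topology_eqOn_twoPhase (φ s)),
    lagrangian_congr hP lam (P.topology_eqOn_twoPhase (φ t))]
  ring

end DesignProblem

end

end LevelSetDescent

theorem mainTheorem1 {n N p : ℕ} (P : LevelSetDescent.DesignProblem n N p) (hP : P.IsAdmissible)
    (k lam T : ℝ) (hk : 0 < k) (hT : 0 < T)
    (φ : ℝ → EuclideanSpace ℝ (Fin n) → ℝ) (hφ : P.IsLevelSetEvolution k lam T φ) :
    (∀ t ∈ Set.Icc 0 T, P.RegularMovingInterface φ t →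
      ∃ L' : ℝ, HasDerivWithinAt (fun s => P.lagrangian lam (P.topology (φ s))) L'
        (Set.Icc 0 T) t ∧ L' < 0) ∧
    ((∀ t ∈ Set.Icc 0 T, P.RegularMovingInterface φ t) →
      StrictAntiOn (fun s => P.lagrangian lam (P.topology (φ s))) (Set.Icc 0 T)) := by
  -- The derivative is two-sided even at `0` and `T`, as `φ` is `C¹` beyond the interval and the
  -- evolution equation is used only at time `t`.
  have key : ∀ t ∈ Set.Icc 0 T, P.RegularMovingInterface φ t →
      ∃ L' : ℝ, HasDerivAt (fun s => P.lagrangian lam (P.topology (φ s))) L' t ∧ L' < 0 := by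
    intro t ht hR
    rcases n with _ | m
    -- In dimension zero every gradient vanishes, so an interface point contradicts regularity.
    · obtain ⟨x, hx, -⟩ := hR.moving
      exact (hR.gradient_ne_zero x (subset_closure hx.1) hx.2 (Subsingleton.elim _ _)).elim
    · exact LevelSetDescent.DesignProblem.exists_hasDerivAt_lagrangian hP hk hφ ht hR
  refine ⟨fun t ht hR => ?_, fun hR => ?_⟩
  · obtain ⟨L', hL', hneg⟩ := key t ht hR
    exact ⟨L', hL'.hasDerivWithinAt, hneg⟩
  · refine strictAntiOn_of_deriv_neg (convex_Icc 0 T) (fun t ht => ?_) fun t ht => ?_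
    · obtain ⟨L', hL', -⟩ := key t ht (hR t ht)
      exact hL'.continuousAt.continuousWithinAt
    · have ht' := interior_subset ht
      obtain ⟨L', hL', hneg⟩ := key t ht' (hR t ht')
      rw [hL'.deriv]
      exact hneg
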